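/- **Setting.** For real numbers $t_1<\dots<t_n$ with $n>d\ge 0$, the cyclic polytope $C(n,d)\subset\mathbb R^d$ is the convex hull of the points $\nu(t_1),\dots,\nu(t_n)$ on the moment curve $\nu(t)=(t,t^2,\dots,t^d)$; $C(d+1,d)$ is the cyclic $d$-simplex. A face of a polytope $P$ is the set of maximizers on $P$ of a linear functional (faces are taken non-empty), $\operatorname{Lin}F$ is the linear span of the differences of points of $F$, and a facet of $F$ is a face of $F$ of dimension $\dim F-1$. *Frames.* A frame is an ordered basis $(v_1,\dots,v_d)$ of $\mathbb R^d$; let $V_k=\langle v_1,\dots,v_k\rangle$ and let $\pi_k:\mathbb R^d\to V_k$ fix $v_i$ for $i\le k$ and kill $v_i$ for $i>k$. The frame is $P$-admissible if $\pi_k:\operatorname{Lin}F\to V_k$ is an isomorphism for every $k$-face $F$ of $P$; write $\sigma_k^F$ for its inverse, and orient $F$ by $\beta_F=\sigma_k^F(v_1)\wedge\dots\wedge\sigma_k^F(v_k)$ (with $\beta_F=1$ if $k=0$). A facet $E$ of a face $F$ lies in the source $\mathrm s(F)$ (resp. the target $\mathrm t(F)$) if there are $v\in\operatorname{Lin}F$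 and a functional $\psi$ whose set of maximizers on $F$ is exactly $E$, with $\psi(v)<0$ (resp. $\psi(v)>0$), such that $\beta_F$ is a positive multiple of $\beta_E\wedge v$. An inhomogeneous cellular string is a sequence $F_1,\dots,F_m$ of faces of $P$ such that for each $i<m$ either $F_i\in\mathrm s(F_{i+1})$ or $F_{i+1}\in\mathrm t(F_i)$; it is an inhomogeneous cellular loop if $F_i=F_j$ for some $i\ne j$. The framed polytope is strongly loop-free if it has no inhomogeneous cellular loop. Its chain complex $\mathcal C(P)$ is the free abelian group on the faces, graded by dimension, with $\partial F=\sum_{E\in \mathrm t(F)}E-\sum_{E\in \mathrm s(F)}E$ and augmentation $\varepsilon=1$ on vertices. *Steiner diagrams.* A based augmented chain complex is an augmented chain complex $\mathbb Z\xleftarrow{\varepsilon}C_0\xleftarrow{\partial}C_1\leftarrow\cdots$ (so $\partial\partial=0$ and $\varepsilon\partial=0$) of free abelian groups with chosen bases $B_n$ of $C_n$, such that $\varepsilon=1$ on $B_0$; isomorphisms are mutually inverse augmentation-preserving chain maps that send basis elements to non-negative combinations of basis elements. Let $\partial^+c$ and $\partial^-c$ be the positive and negative parts of $\partial c$, and for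 $c\in C_n$, $k\le n$, let $\langle c\rangle^\pm_k=(\partial^\pm)^{n-k}c$. The basis is *unital* if $\varepsilon\langle b\rangle_0^\pm=1$ for all basis elements $b$. It is *loop-free* if for every $k$ the transitive closure of the relation "some basis element occurs in both $\langle b\rangle_k^+$ and $\langle b'\rangle_k^-$" on basis elements of degree $>k$ is a strict partial order, and *strongly loop-free* if the transitive closure of the relation "$b$ occurs in $\partial^-b'$ or $b'$ occurs in $\partial^+b$" on all basis elements is a strict partial order. A *strong Steiner diagram* is a based augmented chain complex whose basis is unital, loop-free and strongly loop-free. *Street's $d$-th oriental* $\mathcal C(\triangle_d)$ is the based augmented chain complex whose basis in degree $k$ consists of the $(k+1)$-element subsets $[p_0<\dots<p_k]$ of $\{0,\dots,d\}$, with $\partial[p_0,\dots,p_k]=\sum_{i=0}^k(-1)^i[p_0,\dots,p_{i-1},p_{i+1},\dots,p_k]$ and $\varepsilon[p_0]=1$. **Theorem.** 1. For every $d\ge0$ and all $t_1<\dots<t_{d+1}$, the frame $(e_1,-e_2,\dots,(-1)^{d-1}e_d)$ is admissible for the cyclic $d$-simplex $C(d+1,d)$, and with this frame $C(d+1,d)$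 has no inhomogeneous cellular loops, its chain complex is a strong Steiner diagram, and this chain complex is isomorphic, as a based augmented chain complex, to Street's $d$-th oriental $\mathcal C(\triangle_d)$. 2. For all $n>d\ge0$ and all $t_1<\dots<t_n$, the canonical frame $(e_1,\dots,e_d)$ is admissible for the cyclic polytope $C(n,d)$, and with this frame $C(n,d)$ has no inhomogeneous cellular loops and its chain complex is a strong Steiner diagram. -/

import Mathlib

noncomputable section

namespace FramedPolytope

/-! ### Based augmented chain complexes and Steiner diagrams -/

/-- The data of a based augmented chain complex: a graded basis `Cell`, and on the free abelian
groups `C_n = ℤ{Cell n}` boundary maps `C_{n+1} → C_n` and an augmentation `C_0 → ℤ`.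
The equations are imposed by `BasedData.IsComplex`. -/
structure BasedData where
  Cell : ℕ → Type
  bd : ∀ n, (Cell (n + 1) →₀ ℤ) →ₗ[ℤ] (Cell n →₀ ℤ)
  aug : (Cell 0 →₀ ℤ) →ₗ[ℤ] ℤ

namespace BasedData

variable (C D : BasedData)

/-- The group of `n`-chains. -/
abbrev Chain (n : ℕ) : Type := C.Cell n →₀ ℤ

/-- A basis element, seen as a chain. -/
abbrev basisElt {n : ℕ} (b : C.Cell n) : C.Chain n := Finsupp.single b 1

/-- `∂ ∘ ∂ = 0`, `ε ∘ ∂ = 0`, and `ε(b) = 1` for every basis element `b` of degree `0`. -/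
structure IsComplex : Prop where
  bd_bd : ∀ n (c : C.Chain (n + 2)), C.bd n (C.bd (n + 1) c) = 0
  aug_bd : ∀ c : C.Chain 1, C.aug (C.bd 0 c) = 0
  aug_basis : ∀ b : C.Cell 0, C.aug (C.basisElt b) = 1

/-- `∂⁺ c` (for `true`) and `∂⁻ c` (for `false`): the positive and the negative part of `∂ c`. -/
def bdSign (ε : Bool) {n : ℕ} (c : C.Chain (n + 1)) : C.Chain n :=
  if ε then (C.bd n c)⁺ else (C.bd n c)⁻

/-- `⟨c⟩_k^ε` for a chain `c` of degree `k + j`: apply `∂^ε` to `c` exactly `j` times. -/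
def angle (ε : Bool) (k : ℕ) : ∀ j : ℕ, C.Chain (k + j) → C.Chain k
  | 0, c => c
  | j + 1, c => angle ε k j (C.bdSign ε c)

/-- The basis is unital: `ε(⟨b⟩_0^±) = 1` for every basis element `b`, of any degree `j = 0 + j`. -/
def Unital : Prop :=
  ∀ (ε : Bool) (j : ℕ) (b : C.Cell (0 + j)), C.aug (C.angle ε 0 j (C.basisElt b)) = 1

/-- The relation `b <_k b'` on basis elements of degree greater than `k`: some basis element
occurs in both `⟨b⟩_k^+` and `⟨b'⟩_k^-`. -/
def ltDeg (k : ℕ) (b b' : Σ j : ℕ, C.Cell (k + (j + 1))) : Prop :=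
  ∃ e : C.Cell k, C.angle true k (b.1 + 1) (C.basisElt b.2) e ≠ 0 ∧
    C.angle false k (b'.1 + 1) (C.basisElt b'.2) e ≠ 0

/-- The basis is loop-free: for each `k` the transitive closure of `<_k` is a (strict) partial
order. -/
def LoopFree : Prop :=
  ∀ k : ℕ, IsStrictOrder (Σ j : ℕ, C.Cell (k + (j + 1))) (Relation.TransGen (C.ltDeg k))

/-- The relation `<_ℕ` on all basis elements: `b <_ℕ b'` if `b` occurs in `∂⁻ b'` or `b'` occurs
in `∂⁺ b`. -/
inductive LtNat : (Σ n : ℕ, C.Cell n) → (Σ n : ℕ, C.Cell n) → Prop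
  | source {n : ℕ} (b : C.Cell n) (b' : C.Cell (n + 1))
      (h : C.bdSign false (C.basisElt b') b ≠ 0) : LtNat ⟨n, b⟩ ⟨n + 1, b'⟩
  | target {n : ℕ} (b : C.Cell (n + 1)) (b' : C.Cell n)
      (h : C.bdSign true (C.basisElt b) b' ≠ 0) : LtNat ⟨n + 1, b⟩ ⟨n, b'⟩

/-- The basis is strongly loop-free: the transitive closure of `<_ℕ` is a (strict) partial
order. -/
def StronglyLoopFree : Prop :=
  IsStrictOrder (Σ n : ℕ, C.Cell n) (Relation.TransGen C.LtNat)

/-- A Steiner diagram: a based augmented chain complex whose basis is unital and loop-free. -/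
structure IsSteinerDiagram : Prop where
  isComplex : C.IsComplex
  unital : C.Unital
  loopFree : C.LoopFree

/-- A strong Steiner diagram: a Steiner diagram whose basis is strongly loop-free. -/
structure IsStrongSteinerDiagram : Prop extends C.IsSteinerDiagram where
  stronglyLoopFree : C.StronglyLoopFree

/-- Augmentation-preserving non-negative chain maps. -/
structure Hom where
  map : ∀ n, C.Chain n →ₗ[ℤ] D.Chain n
  map_bd : ∀ n (c : C.Chain (n + 1)), map n (C.bd n c) = D.bd n (map (n + 1) c)
  map_aug : ∀ c : C.Chain 0, D.aug (map 0 c) = C.aug c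
  map_nonneg : ∀ n (b : C.Cell n), 0 ≤ map n (C.basisElt b)

/-- Isomorphisms of based augmented chain complexes: mutually inverse augmentation-preserving
non-negative chain maps. -/
structure Iso where
  hom : C.Hom D
  inv : D.Hom C
  inv_hom : ∀ n (c : C.Chain n), inv.map n (hom.map n c) = c
  hom_inv : ∀ n (c : D.Chain n), hom.map n (inv.map n c) = c

end BasedData

/-! ### Street's orientals -/

/-- Deleting the `i`-th smallest element (counting from `0`) of an `(n+2)`-element subset. -/
def deleteNth {d n : ℕ} (s : {s : Finset (Fin (d + 1)) // s.card = n + 2}) (i : Fin (n + 2)) :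
    {s : Finset (Fin (d + 1)) // s.card = n + 1} :=
  ⟨s.1.erase (s.1.orderEmbOfFin s.2 i), by
    rw [Finset.card_erase_of_mem (Finset.orderEmbOfFin_mem _ _ _), s.2]; rfl⟩

/-- Street's `d`-th oriental: the basis in degree `n` consists of the subsets of `{0, …, d}` of
cardinality `n + 1`, with `∂[p_0,…,p_k] = ∑ (-1)^i [p_0,…,p_{i-1},p_{i+1},…,p_k]` and
`ε[p_0] = 1`. -/
def streetOriental (d : ℕ) : BasedData where
  Cell n := {s : Finset (Fin (d + 1)) // s.card = n + 1}
  bd n := Finsupp.linearCombination ℤ fun s =>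
    ∑ i : Fin (n + 2), Finsupp.single (deleteNth s i) ((-1 : ℤ) ^ (i : ℕ))
  aug := Finsupp.linearCombination ℤ fun _ => (1 : ℤ)

/-! ### Polytopes and their faces -/

variable {d : ℕ}

/-- `F` is a non-empty face of `P`: the locus where some linear functional is maximal on `P`. -/
def IsFace (P F : Set (Fin d → ℝ)) : Prop := IsExposed ℝ P F ∧ F.Nonempty

/-- The linear span `Lin P`, spanned by the differences of points of `P`. -/
abbrev lin (P : Set (Fin d → ℝ)) : Submodule ℝ (Fin d → ℝ) := vectorSpan ℝ P

/-- The dimension of a non-empty polytope. -/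
def dim (P : Set (Fin d → ℝ)) : ℕ := Module.finrank ℝ (lin P)

theorem dim_le (P : Set (Fin d → ℝ)) : dim P ≤ d := by
  simpa [dim] using Submodule.finrank_le (lin P)

/-- `E` is a facet of `F`: a face of codimension one. -/
def IsFacet (F E : Set (Fin d → ℝ)) : Prop := IsFace F E ∧ dim E + 1 = dim F

/-- The normal cone of a face `F` of `P`: the functionals that are maximal on `P` exactly
on `F`. -/
def normalCone (P F : Set (Fin d → ℝ)) : Set (StrongDual ℝ (Fin d → ℝ)) :=
  {ψ | F = ψ.toExposed P}

/-! ### Orientations, sources and targets -/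

/-- Two elements of the exterior algebra are equivalent if they are positive multiples of each
other. -/
def OrientEquiv (β β' : ExteriorAlgebra ℝ (Fin d → ℝ)) : Prop := ∃ r : ℝ, 0 < r ∧ β = r • β'

/-- The source of `F` for `β`, where `β G` is a multivector representing an orientation of `Lin G`
(inside the exterior algebra of the ambient space) for each face `G`. -/
def source (β : Set (Fin d → ℝ) → ExteriorAlgebra ℝ (Fin d → ℝ)) (F : Set (Fin d → ℝ)) :
    Set (Set (Fin d → ℝ)) :=
  {E | IsFacet F E ∧ ∃ v ∈ lin F, ∃ ψ ∈ normalCone F E,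
    ψ v < 0 ∧ OrientEquiv (β F) (β E * ExteriorAlgebra.ι ℝ v)}

/-- The target of `F` for `β`. -/
def target (β : Set (Fin d → ℝ) → ExteriorAlgebra ℝ (Fin d → ℝ)) (F : Set (Fin d → ℝ)) :
    Set (Set (Fin d → ℝ)) :=
  {E | IsFacet F E ∧ ∃ v ∈ lin F, ∃ ψ ∈ normalCone F E,
    0 < ψ v ∧ OrientEquiv (β F) (β E * ExteriorAlgebra.ι ℝ v)}

/-! ### Frames -/

/-- A frame of `ℝ^d`: an ordered basis. -/
abbrev Frame (d : ℕ) : Type := Module.Basis (Fin d) ℝ (Fin d → ℝ)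

/-- The subspace `V_k` spanned by the first `k` vectors of the frame. -/
def Frame.subspace (v : Frame d) (k : ℕ) : Submodule ℝ (Fin d → ℝ) :=
  Submodule.span ℝ (v '' {i | (i : ℕ) < k})

/-- The projection `π_k` onto `V_k`, fixing the first `k` vectors of the frame and killing the
other ones. -/
def Frame.proj (v : Frame d) (k : ℕ) : (Fin d → ℝ) →ₗ[ℝ] (Fin d → ℝ) :=
  v.constr ℝ fun i => if (i : ℕ) < k then v i else 0

/-- The frame is `P`-admissible: for each `k`-face `F`, the map `π_k : Lin F → V_k` is a linear
isomorphism. -/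
def Frame.Admissible (v : Frame d) (P : Set (Fin d → ℝ)) : Prop :=
  ∀ F, IsFace P F → Set.BijOn (v.proj (dim F)) (lin F) (v.subspace (dim F))

/-- The map `σ_k^F : V_k → Lin F` inverse to `π_k`, where `k = dim F`. -/
def Frame.lift (v : Frame d) (F : Set (Fin d → ℝ)) : (Fin d → ℝ) → (Fin d → ℝ) :=
  Function.invFunOn (v.proj (dim F)) (lin F)

/-- The orientation `σ_k^F(v_1) ∧ ⋯ ∧ σ_k^F(v_k)` of a `k`-face `F` induced by the frame;
for `k = 0` it is `1`. -/
def Frame.orientation (v : Frame d) (F : Set (Fin d → ℝ)) : ExteriorAlgebra ℝ (Fin d → ℝ) :=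
  ExteriorAlgebra.ιMulti ℝ (dim F) fun i => v.lift F (v (Fin.castLE (dim_le F) i))

/-! ### Inhomogeneous cellular strings and loops -/

/-- An inhomogeneous cellular string: a sequence `F_1, …, F_m` of faces of `P` such that for each
`i < m` either `F_i` is in the source of `F_{i+1}`, or `F_{i+1}` is in the target of `F_i`. -/
def IsInhomogeneousString (P : Set (Fin d → ℝ)) (v : Frame d) {m : ℕ}
    (F : Fin m → Set (Fin d → ℝ)) : Prop :=
  (∀ i, IsFace P (F i)) ∧
    ∀ i j : Fin m, (j : ℕ) = i + 1 →
      F i ∈ source v.orientation (F j) ∨ F j ∈ target v.orientation (F i)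

/-- An inhomogeneous cellular loop: an inhomogeneous cellular string with a repetition. -/
def IsInhomogeneousLoop (P : Set (Fin d → ℝ)) (v : Frame d) {m : ℕ}
    (F : Fin m → Set (Fin d → ℝ)) : Prop :=
  IsInhomogeneousString P v F ∧ ∃ i j, i ≠ j ∧ F i = F j

/-- Strong loop-freeness: there is no inhomogeneous cellular loop. -/
def StronglyLoopFree (P : Set (Fin d → ℝ)) (v : Frame d) : Prop :=
  ∀ (m : ℕ) (F : Fin m → Set (Fin d → ℝ)), ¬ IsInhomogeneousLoop P v F

/-! ### The chain complex of a polytope -/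

/-- The based augmented chain complex of `P` with orientations `β`: the basis in degree `n` is the
set of `n`-faces, with `∂ F = ∑ target(F) - ∑ source(F)` and `ε` equal to `1` on each vertex.
(The sums are finite since a polytope has finitely many faces, and a face of a face of `P` is a
face of `P`.) -/
def chains (P : Set (Fin d → ℝ)) (β : Set (Fin d → ℝ) → ExteriorAlgebra ℝ (Fin d → ℝ)) :
    BasedData where
  Cell n := {F : Set (Fin d → ℝ) // IsFace P F ∧ dim F = n}
  bd n := Finsupp.linearCombination ℤ fun F =>
    (∑ᶠ (E : {E : Set (Fin d → ℝ) // IsFace P E ∧ dim E = n}) (_ : E.1 ∈ target β F.1),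
      Finsupp.single E (1 : ℤ)) -
    (∑ᶠ (E : {E : Set (Fin d → ℝ) // IsFace P E ∧ dim E = n}) (_ : E.1 ∈ source β F.1),
      Finsupp.single E (1 : ℤ))
  aug := Finsupp.linearCombination ℤ fun _ => (1 : ℤ)

/-- The chain complex of a polytope framed by `v`. -/
def framedChains (P : Set (Fin d → ℝ)) (v : Frame d) : BasedData := chains P v.orientation

/-! ### Cyclic polytopes -/

/-- The moment curve `t ↦ (t, t², …, t^d)`. -/
def momentCurve (d : ℕ) (t : ℝ) : Fin d → ℝ := fun i => t ^ ((i : ℕ) + 1)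

/-- The convex hull of the points with parameters `t_1, …, t_n` on the moment curve in `ℝ^d`; this
is the cyclic polytope `C(n,d)` if `t_1 < ⋯ < t_n` and `n > d`, and the cyclic `d`-simplex if
moreover `n = d + 1`. -/
def cyclicPolytope (d : ℕ) {n : ℕ} (t : Fin n → ℝ) : Set (Fin d → ℝ) :=
  convexHull ℝ (Set.range fun i => momentCurve d (t i))

/-- The canonical frame `(e_1, …, e_d)`. -/
def canonicalFrame (d : ℕ) : Frame d := Pi.basisFun ℝ (Fin d)

/-- The frame `(e_1, -e_2, …, (-1)^{d-1} e_d)`. -/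
def alternatingFrame (d : ℕ) : Frame d :=
  (canonicalFrame d).unitsSMul fun i => (-1 : ℝˣ) ^ (i : ℕ)

end FramedPolytope

end

noncomputable section

namespace FramedPolytope

/-! ### Parity of gaps -/

section Gaps

variable {ι : Type*} (f : ι → ℝ) (q : ℕ)

/-! Both frames are diagonal, so the structure can be read off from sets of vertices. A nonzero
polynomial of degree at most d has at most d roots; hence proper faces of the cyclic polytope are
simplices on their vertices (`IsFaceSet.dim_cases`), and truncation to the first k coordinates is an
isomorphism on the linear span of a k-face (`bijOn_proj_hull`), which is admissibility.

Let E of dimension k and F of dimension k + 1 be faces with vertex sets J ⊆ I. Functionals on Lin F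
that kill Lin E are proportional, so an outer normal of E can be compared with the monic polynomial
having roots at J: whether E is in the source or the target depends on its sign on I \ J
(`mem_source_target_cyclic_iff`). That sign is a parity of the number of elements of J beyond a
given vertex, as in Gale's evenness criterion. With f = t, q = 0 for the canonical frame and f = -t,
q = 1 for the alternating one, sources are the sections of even level and targets those of odd level
(`mem_source_target_iff_isSection`).

The rest is combinatorics of sections, collected in `VertexModel`. By a cancellation in words of
parities (`sum_isSection_insert`), the boundary of the sum of all sections of one sign is the sum of
the odd minus the sum of the even sections one degree lower. Hence iterated sources and targets are
sums of sections (`angle_basisElt`), ∂∂ = 0, and unitality says that there is exactly one section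
with a single point. Every kind of loop-freeness comes from one strict order, the Gray code order on
vertex sets, which increases from a source to its cell and from a cell to its target
(`IsSection.grayLT`). The oriental obeys the same rules with f = -t, q = 1, and all non-empty vertex
sets of a simplex span faces, so the two complexes agree. -/

/-- The number of elements of `J` above `i` for the ordering of the indices by `f`, shifted
by `q`. -/
def level (J : Finset ι) (i : ι) : ℕ := (J.filter fun j => f i < f j).card + q

/-- `J ⊆ I`, and the levels of all elements of `I \ J` are odd (if `ε = true`) or even
(if `ε = false`). -/
def IsSection (ε : Bool) (J I : Finset ι) : Prop :=
  J ⊆ I ∧ ∀ i ∈ I, i ∉ J → (Odd (level f q J i) ↔ ε = true)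

variable {f q}

theorem level_insert [DecidableEq ι] {K : Finset ι} {r : ι} (hr : r ∉ K) (g : ι) :
    level f q (insert r K) g = level f q K g + if f g < f r then 1 else 0 := by
  unfold level
  rw [Finset.filter_insert]
  split_ifs with h
  · rw [Finset.card_insert_of_notMem (by simp [hr])]; omega
  · simp

open scoped Classical in
-- Only `r` is missing, so being a section is one parity condition, and it holds for exactly one of
-- the two signs.
theorem isSection_insert_sub [DecidableEq ι] {K : Finset ι} {r : ι} (hr : r ∉ K) :
    ((if IsSection f q true K (insert r K) then 1 else 0) -
      if IsSection f q false K (insert r K) then 1 else 0 : ℤ) = -(-1) ^ level f q K r := by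
  have hs : ∀ ε, IsSection f q ε K (insert r K) ↔ (Odd (level f q K r) ↔ ε = true) := by
    intro ε
    simp only [IsSection, Finset.subset_insert, true_and, Finset.forall_mem_insert, hr,
      not_false_eq_true, forall_const]
    exact and_iff_left fun g hg hg' => absurd hg hg'
  simp only [hs]
  by_cases hodd : Odd (level f q K r)
  · simp [hodd, hodd.neg_one_pow]
  · simp [hodd, (Nat.not_odd_iff_even.1 hodd).neg_one_pow]

open scoped Classical in
/-- In a word of parities, the letters such that all smaller letters are odd and all larger ones
are even cancel unless the word is constant. -/
theorem sum_neg_one_pow_of_separating (hf : Function.Injective f) (G : Finset ι) (a : ι → ℕ) :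
    ∑ r ∈ G, (if ∀ g ∈ G, g ≠ r → (Odd (a g) ↔ f g < f r) then -(-1 : ℤ) ^ a r else 0) =
      (if ∀ g ∈ G, Odd (a g) then 1 else 0) - if ∀ g ∈ G, ¬ Odd (a g) then 1 else 0 := by
  induction G using Finset.induction_on_max_value f with
  | empty => simp
  | insert x G hx hmax ih =>
    have hlt : ∀ g ∈ G, f g < f x := fun g hg =>
      lt_of_le_of_ne (hmax g hg) fun h => hx (hf h ▸ hg)
    have hne : ∀ g ∈ G, g ≠ x := fun g hg h => hx (h ▸ hg)
    -- A separating letter exists only if the word consists of odd letters followed by even ones.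
    -- When both kinds occur, the last odd and the first even letter separate, and they contribute 1
    -- and -1. The induction removes the largest letter, which separates exactly when all others are
    -- odd.
    have top : (∀ g ∈ insert x G, g ≠ x → (Odd (a g) ↔ f g < f x)) ↔ ∀ g ∈ G, Odd (a g) := by
      constructor
      · intro h g hg
        exact (h g (Finset.mem_insert_of_mem hg) (hne g hg)).2 (hlt g hg)
      · intro h g hg hgx
        have hg' := Finset.mem_of_mem_insert_of_ne hg hgx
        simp [h g hg', hlt g hg']
    have rest : ∀ r ∈ G, ((∀ g ∈ insert x G, g ≠ r → (Odd (a g) ↔ f g < f r)) ↔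
        ¬ Odd (a x) ∧ ∀ g ∈ G, g ≠ r → (Odd (a g) ↔ f g < f r)) := by
      intro r hr
      rw [Finset.forall_mem_insert]
      have h1 := hne r hr
      have h2 := hlt r hr
      simp [h1.symm, not_lt.2 h2.le]
    rw [Finset.sum_insert hx, Finset.sum_congr rfl fun r hr => by rw [if_congr (rest r hr) rfl rfl]]
    rw [if_congr top rfl rfl]
    simp only [Finset.forall_mem_insert]
    by_cases hax : Odd (a x)
    · simp [hax, hax.neg_one_pow]
    · simp only [hax, not_false_eq_true, true_and, false_and, if_false] at ih ⊢
      rw [ih, (Nat.not_odd_iff_even.1 hax).neg_one_pow]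
      split_ifs <;> simp

open scoped Classical in
/-- The coefficients of the boundary of the sum of all sections. -/
theorem sum_isSection_insert (hf : Function.Injective f) (ε : Bool) {K I : Finset ι} (hK : K ⊆ I) :
    ∑ r ∈ I \ K, (if IsSection f q ε (insert r K) I then -(-1 : ℤ) ^ level f q K r else 0) =
      (if IsSection f q true K I then 1 else 0) - if IsSection f q false K I then 1 else 0 := by
  -- Adding `r` to `K` raises by one the levels of the elements below `r`. After a shift by `ε`, the
  -- condition therefore says that `r` separates the odd letters from the even ones.
  have key : ∀ r ∈ I \ K, (IsSection f q ε (insert r K) I ↔ ∀ g ∈ I \ K, g ≠ r →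
      (Odd (level f q K g + if ε then 1 else 0) ↔ f g < f r)) := by
    intro r hr
    obtain ⟨hrI, hrK⟩ := Finset.mem_sdiff.1 hr
    simp only [IsSection, Finset.insert_subset_iff, hrI, hK, true_and, Finset.mem_insert, not_or,
      Finset.mem_sdiff, level_insert hrK, and_imp]
    refine forall_congr' fun g => forall_congr' fun _ => ?_
    have : ∀ n : ℕ, ((Odd (n + if f g < f r then 1 else 0) ↔ ε = true) ↔
        (Odd (n + if ε = true then 1 else 0) ↔ f g < f r)) := by
      intro n
      by_cases h1 : f g < f r <;> cases ε <;> simp [h1, Nat.odd_add_one]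
    rw [this]
    tauto
  rw [Finset.sum_congr rfl fun r hr => by rw [if_congr (key r hr) rfl rfl]]
  have hT : IsSection f q true K I ↔ ∀ g ∈ I \ K, Odd (level f q K g) := by
    simp [IsSection, hK]
  have hF : IsSection f q false K I ↔ ∀ g ∈ I \ K, ¬ Odd (level f q K g) := by
    simp [IsSection, hK]
  have word := sum_neg_one_pow_of_separating hf (I \ K)
    fun g => level f q K g + if ε then 1 else 0
  rw [hT, hF]
  cases ε
  · simpa using word
  -- The shift by one reverses all signs and exchanges the two constant words, so the identity for
  -- words is used with both sides negated.
  · simp only [if_true, pow_succ, mul_neg, mul_one, neg_neg, Nat.odd_add_one, not_not] at word ⊢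
    rw [← neg_inj, ← Finset.sum_neg_distrib]
    simp only [apply_ite Neg.neg, neg_neg, neg_zero, neg_sub]
    convert word

/-! ### The ordering of subsets -/

variable (f q) in
/-- The parity of the number of elements of `A` that are at least `i`, shifted by `q`. -/
def grayBit (A : Finset ι) (i : ι) : Prop := Odd ((A.filter fun j => f i ≤ f j).card + q)

variable (f q) in
/-- The Gray code ordering of finite sets: reflected lexicographic ordering from above. -/
def GrayLT (A B : Finset ι) : Prop :=
  ∃ i, (∀ g, f i < f g → (grayBit f q A g ↔ grayBit f q B g)) ∧ ¬ grayBit f q A i ∧ grayBit f q B i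

theorem GrayLT.irrefl (A : Finset ι) : ¬ GrayLT f q A A := fun ⟨_, _, h, h'⟩ => h h'

theorem GrayLT.trans (hf : Function.Injective f) {A B C : Finset ι} (h : GrayLT f q A B)
    (h' : GrayLT f q B C) : GrayLT f q A C := by
  obtain ⟨i, hi, ha, hb⟩ := h
  obtain ⟨j, hj, hb', hc⟩ := h'
  rcases lt_trichotomy (f i) (f j) with hij | hij | hij
  · exact ⟨j, fun g hg => (hi g (hij.trans hg)).trans (hj g hg), fun h => hb' ((hi j hij).1 h), hc⟩
  · exact absurd (hf hij ▸ hb) hb'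
  · exact ⟨i, fun g hg => (hi g hg).trans (hj g (hij.trans hg)), ha, (hj i hij).1 hb⟩

/-- Take the largest element i of `I \ J`. Above i the two sets agree, hence so do their bits. At i
the bit of `J` is the parity of the level of i, and i itself flips the bit of `I`; the parity
prescribed by `ε` decides the direction. -/
theorem IsSection.grayLT (hf : Function.Injective f) {ε : Bool} {J I : Finset ι}
    (h : IsSection f q ε J I) (hne : J ≠ I) :
    if ε then GrayLT f q I J else GrayLT f q J I := by
  classical
  have hG : (I \ J).Nonempty :=
    Finset.sdiff_nonempty.2 fun h' => hne (h.1.antisymm h')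
  obtain ⟨i, hi, hmax⟩ := Finset.exists_max_image (I \ J) f hG
  obtain ⟨hiI, hiJ⟩ := Finset.mem_sdiff.1 hi
  have above : ∀ g, f i < f g → (g ∈ I ↔ g ∈ J) := fun g hg =>
    ⟨fun hgI => by_contra fun hgJ => (hmax g (Finset.mem_sdiff.2 ⟨hgI, hgJ⟩)).not_gt hg,
      fun hgJ => h.1 hgJ⟩
  have hbits : ∀ g, f i < f g → (grayBit f q I g ↔ grayBit f q J g) := by
    intro g hg
    have : (I.filter fun j => f g ≤ f j) = J.filter fun j => f g ≤ f j := by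
      ext j
      simp only [Finset.mem_filter, and_congr_left_iff]
      exact fun hj => above j (hg.trans_le hj)
    rw [grayBit, this, grayBit]
  have hJ : (J.filter fun j => f i ≤ f j) = J.filter fun j => f i < f j := by
    refine Finset.filter_congr fun j hj => ⟨fun h => lt_of_le_of_ne h fun h' => ?_, le_of_lt⟩
    exact hiJ (hf h' ▸ hj)
  have hI : (I.filter fun j => f i ≤ f j) = insert i (J.filter fun j => f i < f j) := by
    ext j
    simp only [Finset.mem_filter, Finset.mem_insert]
    constructor
    · rintro ⟨hj, hle⟩
      rcases hle.eq_or_lt with he | hlt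
      · exact Or.inl (hf he.symm)
      · exact Or.inr ⟨(above j hlt).1 hj, hlt⟩
    · rintro (rfl | ⟨hj, hlt⟩)
      · exact ⟨hiI, le_rfl⟩
      · exact ⟨h.1 hj, hlt.le⟩
  have bJ : grayBit f q J i ↔ Odd (level f q J i) := by rw [grayBit, hJ, level]
  have bI : grayBit f q I i ↔ ¬ Odd (level f q J i) := by
    rw [grayBit, hI, Finset.card_insert_of_notMem (by simp), level, add_right_comm,
      Nat.odd_add_one]
  have hpar := h.2 i hiI hiJ
  cases ε
  · exact ⟨i, fun g hg => (hbits g hg).symm, by simp_all, by simp_all⟩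
  · exact ⟨i, hbits, by simp_all, by simp_all⟩

/-- Only irreflexivity needs an argument: a relation that increases along one strict order has no
cycles. This serves both algebraic loop-freeness conditions. -/
theorem transGen_isStrictOrder {α : Type*} {r : α → α → Prop} (g : α → Finset ι)
    (hf : Function.Injective f) (h : ∀ a b, r a b → GrayLT f q (g a) (g b)) :
    IsStrictOrder α (Relation.TransGen r) := by
  have mono : ∀ a b, Relation.TransGen r a b → GrayLT f q (g a) (g b) := by
    intro a b hab
    induction hab with
    | single hab => exact h _ _ hab
    | tail _ hbc ih => exact ih.trans hf (h _ _ hbc)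
  exact { irrefl := fun a ha => GrayLT.irrefl _ (mono a a ha)
          trans := fun _ _ _ => Relation.TransGen.trans }

/-- All other elements of `I` must lie on the same side of the chosen point, so it is the minimum or
the maximum, depending on the parity of `q` and on `ε`. This is unitality in combinatorial form. -/
theorem existsUnique_isSection_card_one (hf : Function.Injective f) (ε : Bool) {I : Finset ι}
    (hI : I.Nonempty) : ∃! J : Finset ι, J.card = 1 ∧ IsSection f q ε J I := by
  classical
  -- The level of `g` in a singleton `{i}` is `q + 1` below `i` and `q` above `i`.
  have lev : ∀ i g, level f q {i} g = (if f g < f i then 1 else 0) + q := by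
    intro i g
    unfold level
    rw [Finset.filter_singleton]
    split_ifs <;> simp
  have hsec : ∀ i, IsSection f q ε {i} I ↔
      i ∈ I ∧ ∀ g ∈ I, g ≠ i → ((f g < f i) ↔ ¬ (Odd q ↔ ε = true)) := by
    intro i
    simp only [IsSection, Finset.singleton_subset_iff, Finset.mem_singleton, lev]
    refine and_congr_right fun _ => forall_congr' fun g => forall_congr' fun _ =>
      forall_congr' fun _ => ?_
    by_cases h : f g < f i
    · simp only [h, if_true, true_iff, add_comm 1 q, Nat.odd_add_one]; tauto
    · simp [h]
  suffices ∃! i, i ∈ I ∧ ∀ g ∈ I, g ≠ i → ((f g < f i) ↔ ¬ (Odd q ↔ ε = true)) by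
    obtain ⟨i, hi, huniq⟩ := this
    refine ⟨{i}, ⟨Finset.card_singleton i, (hsec i).2 hi⟩, ?_⟩
    rintro J ⟨hJ, hs⟩
    obtain ⟨j, rfl⟩ := Finset.card_eq_one.1 hJ
    rw [huniq j ((hsec j).1 hs)]
  by_cases hq : (Odd q ↔ ε = true)
  · obtain ⟨i, hi, hmin⟩ := Finset.exists_min_image I f hI
    refine ⟨i, ⟨hi, fun g hg _ => by simpa [hq] using hmin g hg⟩, fun j ⟨hj, hj'⟩ => ?_⟩
    by_contra hne
    have h1 := hj' i hi (Ne.symm hne)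
    simp only [hq, not_true, iff_false, not_lt] at h1
    exact hne (hf (le_antisymm h1 (hmin j hj)))
  · obtain ⟨i, hi, hmax⟩ := Finset.exists_max_image I f hI
    refine ⟨i, ⟨hi, fun g hg hgi => ?_⟩, fun j ⟨hj, hj'⟩ => ?_⟩
    · simp only [hq, not_false_eq_true, iff_true]
      exact lt_of_le_of_ne (hmax g hg) fun h => hgi (hf h)
    by_contra hne
    have h1 := hj' i hi (Ne.symm hne)
    simp only [hq, not_false_eq_true, iff_true] at h1
    exact (hmax j hj).not_gt h1

end Gaps

/-! ### Complexes whose cells are sets of vertices -/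

open scoped Classical in
/-- A description of a based augmented chain complex by sets of vertices: the cells are determined
by their vertices, and the target (source) of a cell consists of the sections of odd (even)
level. -/
structure VertexModel (C : BasedData) {ι : Type} (f : ι → ℝ) (q : ℕ) where
  vert : ∀ k, C.Cell k → Finset ι
  vert_injective : ∀ k, Function.Injective (vert k)
  -- The second cell only ensures that `E` does not have top degree: the polytope C(n,d) itself may
  -- have more than d + 1 vertices.
  card_vert : ∀ {k m} (E : C.Cell k) (_ : C.Cell m), k < m → (vert k E).card = k + 1
  lt_card_vert : ∀ {k} (E : C.Cell k), k < (vert k E).card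
  -- Cells are required only for sections, since a general set of vertices of C(n,d) need not span a
  -- face.
  exists_cell : ∀ {ε k m} (F : C.Cell m) (J : Finset ι), k < m → J.card = k + 1 →
    IsSection f q ε J (vert m F) → ∃ E : C.Cell k, vert k E = J
  bd_apply : ∀ {k} (F : C.Cell (k + 1)) (E : C.Cell k), C.bd k (C.basisElt F) E =
    (if IsSection f q true (vert k E) (vert (k + 1) F) then 1 else 0) -
      if IsSection f q false (vert k E) (vert (k + 1) F) then 1 else 0
  aug_eq : C.aug = Finsupp.linearCombination ℤ fun _ => (1 : ℤ)

namespace VertexModel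

variable {C : BasedData} {ι : Type} {f : ι → ℝ} {q : ℕ} (M : VertexModel C f q)

/-- By cardinality some vertex of `F` is missing from `E`, and its level would be both odd and even.
-/
theorem not_isSection_both {k m : ℕ} (F : C.Cell m) (E : C.Cell k) (h : k < m)
    (hT : IsSection f q true (M.vert k E) (M.vert m F))
    (hF : IsSection f q false (M.vert k E) (M.vert m F)) : False := by
  have h1 := M.lt_card_vert F
  have h2 := M.card_vert E F h
  obtain ⟨i, hi, hi'⟩ := Finset.exists_mem_notMem_of_card_lt_card
    (s := M.vert k E) (t := M.vert m F) (by omega)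
  have := hT.2 i hi hi'
  have := hF.2 i hi hi'
  simp_all

theorem vert_ne {k m : ℕ} (E : C.Cell k) (F : C.Cell m) (h : k < m) : M.vert k E ≠ M.vert m F := by
  intro he
  have h1 := M.card_vert E F h
  have h2 := M.lt_card_vert F
  rw [he] at h1
  omega

theorem grayLT_source (hf : Function.Injective f) {k m : ℕ} (E : C.Cell k) (F : C.Cell m)
    (h : k < m) (hs : IsSection f q false (M.vert k E) (M.vert m F)) :
    GrayLT f q (M.vert k E) (M.vert m F) := by
  simpa using hs.grayLT hf (M.vert_ne E F h)

theorem grayLT_target (hf : Function.Injective f) {k m : ℕ} (E : C.Cell k) (F : C.Cell m)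
    (h : k < m) (hs : IsSection f q true (M.vert k E) (M.vert m F)) :
    GrayLT f q (M.vert m F) (M.vert k E) := by
  simpa using hs.grayLT hf (M.vert_ne E F h)

theorem bd_apply_of_insert [DecidableEq ι] {k : ℕ} {E : C.Cell (k + 1)} {K : C.Cell k} {r : ι}
    (hr : r ∉ M.vert k K) (h : insert r (M.vert k K) = M.vert (k + 1) E) :
    C.bd k (C.basisElt E) K = -(-1) ^ level f q (M.vert k K) r := by
  rw [M.bd_apply, ← h, isSection_insert_sub hr]

/-! ### Iterated sources and targets as sums of sections -/

variable [Finite ι]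

open scoped Classical in
/-- The sum of all cells of degree `k` that are sections of `I`. -/
def sectionChain (ε : Bool) (k : ℕ) (I : Finset ι) : C.Chain k :=
  have := Finite.of_injective _ (M.vert_injective k)
  Finsupp.ofSupportFinite (fun E => if IsSection f q ε (M.vert k E) I then 1 else 0)
    (Set.toFinite _)

open scoped Classical in
theorem sectionChain_apply (ε : Bool) (k : ℕ) (I : Finset ι) (E : C.Cell k) :
    M.sectionChain ε k I E = if IsSection f q ε (M.vert k E) I then 1 else 0 := rfl

theorem sectionChain_ne_zero {ε : Bool} {k : ℕ} {I : Finset ι} {E : C.Cell k} :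
    M.sectionChain ε k I E ≠ 0 ↔ IsSection f q ε (M.vert k E) I := by
  classical
  rw [sectionChain_apply]
  split_ifs with h <;> simp [h]

theorem bd_basisElt {k : ℕ} (F : C.Cell (k + 1)) : C.bd k (C.basisElt F) =
    M.sectionChain true k (M.vert _ F) - M.sectionChain false k (M.vert _ F) := by
  classical
  ext E
  rw [M.bd_apply, Finsupp.sub_apply, sectionChain_apply, sectionChain_apply]

/-- The two sums have disjoint supports, so nothing cancels and they are the positive and negative
parts. The chain `c` is left arbitrary in order to cover both a basis element and a sum of sections.
-/
theorem bdSign_eq {k m : ℕ} (F : C.Cell m) (h : k < m) {c : C.Chain (k + 1)}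
    (hc : C.bd k c = M.sectionChain true k (M.vert _ F) - M.sectionChain false k (M.vert _ F))
    (ε : Bool) : C.bdSign ε c = M.sectionChain ε k (M.vert _ F) := by
  classical
  have hb := fun E => M.not_isSection_both F E h
  cases ε
  · ext E
    have := hb E
    simp only [BasedData.bdSign, hc, negPart_def, Bool.false_eq_true, if_false, Finsupp.sup_apply,
      Finsupp.neg_apply, Finsupp.sub_apply, sectionChain_apply, Finsupp.zero_apply]
    split_ifs <;> simp_all
  · ext E
    have := hb E
    simp only [BasedData.bdSign, hc, posPart_def, if_true, Finsupp.sup_apply,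
      Finsupp.sub_apply, sectionChain_apply, Finsupp.zero_apply]
    split_ifs <;> simp_all

theorem bd_chain_apply {k : ℕ} (c : C.Chain (k + 1)) [Fintype (C.Cell (k + 1))] (K : C.Cell k) :
    C.bd k c K = ∑ E, c E * C.bd k (C.basisElt E) K := by
  conv_lhs => rw [← Finsupp.univ_sum_single c, map_sum, Finsupp.finsetSum_apply]
  refine Finset.sum_congr rfl fun E _ => ?_
  rw [← mul_one (c E), ← smul_eq_mul (c E), ← Finsupp.smul_single, map_smul, Finsupp.smul_apply,
    smul_eq_mul, smul_eq_mul, mul_one]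

/-- The boundary of the sum of all sections of `vert F` in some degree. -/
theorem bd_sectionChain (hf : Function.Injective f) (ε : Bool) {k m : ℕ} (F : C.Cell m)
    (h : k + 1 < m) : C.bd k (M.sectionChain ε (k + 1) (M.vert m F)) =
      M.sectionChain true k (M.vert m F) - M.sectionChain false k (M.vert m F) := by
  classical
  have := Finite.of_injective _ (M.vert_injective (k + 1))
  have := Fintype.ofFinite (C.Cell (k + 1))
  ext K
  have hK := M.card_vert K F (by omega)
  rw [bd_chain_apply, Finsupp.sub_apply]
  simp only [sectionChain_apply]
  by_cases hKF : M.vert k K ⊆ M.vert m F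
  swap
  · rw [Finset.sum_eq_zero]
    · simp [IsSection, hKF]
    intro E _
    by_cases hE : IsSection f q ε (M.vert _ E) (M.vert m F)
    · have : ¬ M.vert k K ⊆ M.vert _ E := fun h => hKF (h.trans hE.1)
      simp [M.bd_apply, IsSection, this]
    · simp [hE]
  rw [← sum_isSection_insert hf ε hKF]
  have lhs : ∀ E : C.Cell (k + 1), ((if IsSection f q ε (M.vert _ E) (M.vert m F) then (1 : ℤ) else 0) *
      C.bd k (C.basisElt E) K) ≠ 0 → IsSection f q ε (M.vert _ E) (M.vert m F) ∧
        M.vert k K ⊆ M.vert _ E := by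
    intro E hE
    by_contra hcon
    apply hE
    rw [M.bd_apply]
    by_cases h1 : IsSection f q ε (M.vert _ E) (M.vert m F)
    · have : ¬ M.vert k K ⊆ M.vert _ E := fun h => hcon ⟨h1, h⟩
      simp [IsSection, this]
    · simp [h1]
  symm
  -- The two sums are matched by adding `r` to the vertices of `K`: a nonzero term on either side
  -- comes from a section that contains `K` and has one more element.
  have cell : ∀ r ∈ M.vert m F \ M.vert k K,
      (if IsSection f q ε (insert r (M.vert k K)) (M.vert m F) then
        -(-1 : ℤ) ^ level f q (M.vert k K) r else 0) ≠ 0 →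
      ∃ E : C.Cell (k + 1), M.vert _ E = insert r (M.vert k K) := by
    intro r hr hne
    have hs : IsSection f q ε (insert r (M.vert k K)) (M.vert m F) := by
      by_contra hcon; simp [hcon] at hne
    refine M.exists_cell F _ h ?_ hs
    rw [Finset.card_insert_of_notMem (Finset.mem_sdiff.1 hr).2, hK]
  refine Finset.sum_bij_ne_zero (fun r hr hne => (cell r hr hne).choose) (by simp) ?_ ?_ ?_
  · intro r hr hne r' hr' hne' heq
    have h1 := (cell r hr hne).choose_spec
    have h2 := (cell r' hr' hne').choose_spec
    have h3 : insert r (M.vert k K) = insert r' (M.vert k K) := by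
      rw [← h1, ← h2]; exact congrArg _ heq
    have h4 : r ∈ insert r' (M.vert k K) := h3 ▸ Finset.mem_insert_self _ _
    exact (Finset.mem_insert.1 h4).resolve_right (Finset.mem_sdiff.1 hr).2
  · intro E _ hE
    obtain ⟨h1, h2⟩ := lhs E hE
    have hcE := M.card_vert E F h
    obtain ⟨r, hr, hrE⟩ : ∃ r, r ∉ M.vert k K ∧ insert r (M.vert k K) = M.vert _ E := by
      have := Finset.exists_eq_insert_iff.2 ⟨h2, by omega⟩
      obtain ⟨r, hr, hrE⟩ := this
      exact ⟨r, hr, hrE⟩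
    have hrF : r ∈ M.vert m F \ M.vert k K :=
      Finset.mem_sdiff.2 ⟨h1.1 (hrE ▸ Finset.mem_insert_self _ _), hr⟩
    have hne : (if IsSection f q ε (insert r (M.vert k K)) (M.vert m F) then
        -(-1 : ℤ) ^ level f q (M.vert k K) r else 0) ≠ 0 := by
      rw [hrE, if_pos h1]; simp
    exact ⟨r, hrF, hne, M.vert_injective _ ((cell r hrF hne).choose_spec.trans hrE)⟩
  · intro r hr hne
    have h1 := (cell r hr hne).choose_spec
    have hs : IsSection f q ε (insert r (M.vert k K)) (M.vert m F) := by
      by_contra hcon; simp [hcon] at hne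
    rw [M.bd_apply_of_insert (Finset.mem_sdiff.1 hr).2 h1.symm, h1, if_pos hs, if_pos hs, one_mul]

/-- The boundary of a sum of sections does not depend on the sign of the sections, so its `ε`-part
is again the sum of the sections of sign `ε`, one degree lower. -/
theorem angle_sectionChain (hf : Function.Injective f) (ε : Bool) (k j : ℕ) {m : ℕ}
    (F : C.Cell m) (h : k + j < m) :
    C.angle ε k j (M.sectionChain ε (k + j) (M.vert m F)) = M.sectionChain ε k (M.vert m F) := by
  induction j with
  | zero => rfl
  | succ j ih =>
    have := M.bdSign_eq F (k := k + j) (by omega)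
      (M.bd_sectionChain hf ε F (k := k + j) (by omega)) ε
    change C.angle ε k j (C.bdSign ε _) = _
    exact (congrArg _ this).trans (ih (by omega))

/-- The iterated source (target) of a cell in degree `k`. -/
theorem angle_basisElt (hf : Function.Injective f) (ε : Bool) (k j : ℕ)
    (F : C.Cell (k + (j + 1))) :
    C.angle ε k (j + 1) (C.basisElt F) = M.sectionChain ε k (M.vert _ F) := by
  have := M.bdSign_eq (k := k + j) (m := k + (j + 1)) F (by omega) (M.bd_basisElt (k := k + j) F) ε
  change C.angle ε k j (C.bdSign ε _) = _
  exact (congrArg _ this).trans (M.angle_sectionChain hf ε k j F (by omega))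

/-! ### The axioms of a strong Steiner diagram -/

theorem aug_sectionChain_zero (hf : Function.Injective f) (ε : Bool) {m : ℕ} (F : C.Cell m)
    (h : 0 < m) : C.aug (M.sectionChain ε 0 (M.vert m F)) = 1 := by
  classical
  have hne : (M.vert m F).Nonempty := Finset.card_pos.1 ((Nat.zero_le _).trans_lt (M.lt_card_vert F))
  obtain ⟨J, ⟨hJ, hs⟩, huniq⟩ := existsUnique_isSection_card_one (q := q) hf ε hne
  obtain ⟨E, rfl⟩ := M.exists_cell F J h hJ hs
  have : M.sectionChain ε 0 (M.vert m F) = C.basisElt E := by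
    ext E'
    rw [sectionChain_apply, Finsupp.single_apply]
    refine if_congr ⟨fun h' => ?_, fun h' => h' ▸ hs⟩ rfl rfl
    exact (M.vert_injective 0 (huniq _ ⟨M.card_vert E' F h, h'⟩)).symm
  rw [this, M.aug_eq]
  simp

/-- The sums of odd and of even sections have the same boundary in positive degree and the same
augmentation in degree 0, so their difference is killed. -/
theorem isComplex (M : VertexModel C f q) (hf : Function.Injective f) : C.IsComplex where
  bd_bd n c := by
    have : (C.bd n).comp (C.bd (n + 1)) = 0 := by
      refine Finsupp.lhom_ext' fun F => LinearMap.ext_ring ?_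
      change C.bd n (C.bd (n + 1) (C.basisElt F)) = 0
      rw [M.bd_basisElt, map_sub, M.bd_sectionChain hf _ F (by omega),
        M.bd_sectionChain hf _ F (by omega), sub_self]
    exact LinearMap.congr_fun this c
  aug_bd c := by
    have : C.aug.comp (C.bd 0) = 0 := by
      refine Finsupp.lhom_ext' fun F => LinearMap.ext_ring ?_
      change C.aug (C.bd 0 (C.basisElt F)) = 0
      rw [M.bd_basisElt, map_sub, M.aug_sectionChain_zero hf _ F (by omega),
        M.aug_sectionChain_zero hf _ F (by omega), sub_self]
    exact LinearMap.congr_fun this c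
  aug_basis b := by simp [M.aug_eq]

theorem unital (M : VertexModel C f q) (hf : Function.Injective f) : C.Unital := by
  rintro ε (_ | j) b
  · exact (M.isComplex hf).aug_basis b
  · rw [M.angle_basisElt hf, M.aug_sectionChain_zero hf _ _ (by omega)]

/-- The common element `e` is an odd section of `b` and an even section of `b'`, hence lies strictly
between them in the Gray order. -/
theorem loopFree (M : VertexModel C f q) (hf : Function.Injective f) : C.LoopFree := by
  intro k
  refine transGen_isStrictOrder (f := f) (q := q) (fun b => M.vert _ b.2) hf ?_
  rintro ⟨j, b⟩ ⟨j', b'⟩ ⟨e, h, h'⟩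
  simp only [M.angle_basisElt hf, sectionChain_ne_zero] at h h'
  exact (M.grayLT_target hf e b (by omega) h).trans hf (M.grayLT_source hf e b' (by omega) h')

theorem stronglyLoopFree (M : VertexModel C f q) (hf : Function.Injective f) : C.StronglyLoopFree := by
  refine transGen_isStrictOrder (f := f) (q := q) (fun b => M.vert _ b.2) hf ?_
  rintro _ _ (⟨b, b', h⟩ | ⟨b, b', h⟩)
  · rw [M.bdSign_eq b' (by omega) (M.bd_basisElt b'), sectionChain_ne_zero] at h
    exact M.grayLT_source hf b b' (by omega) h
  · rw [M.bdSign_eq b (by omega) (M.bd_basisElt b), sectionChain_ne_zero] at h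
    exact M.grayLT_target hf b' b (by omega) h

theorem isStrongSteinerDiagram (M : VertexModel C f q) (hf : Function.Injective f) : C.IsStrongSteinerDiagram where
  isComplex := M.isComplex hf
  unital := M.unital hf
  loopFree := M.loopFree hf
  stronglyLoopFree := M.stronglyLoopFree hf

end VertexModel

/-! ### Alternating maps and exterior powers -/

/-- Adding multiples of one argument to the other ones does not change the value of an alternating
map. -/
theorem alternatingMap_add_smul {R M N κ : Type*} [CommRing R] [AddCommGroup M] [Module R M]
    [AddCommGroup N] [Module R N] [Fintype κ] [DecidableEq κ] (g : M [⋀^κ]→ₗ[R] N) (x : κ → M)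
    (c : κ → R) (j : κ) (hc : c j = 0) : g (fun i => x i + c i • x j) = g x := by
  have key : ∀ s : Finset κ, j ∉ s → g (fun i => if i ∈ s then x i + c i • x j else x i) = g x := by
    intro s
    induction s using Finset.induction_on with
    | empty => simp
    | insert a s ha ih =>
      intro hj
      rw [Finset.mem_insert, not_or] at hj
      rw [← ih hj.2]
      set y : κ → M := fun i => if i ∈ s then x i + c i • x j else x i with hy
      have hyj : y j = x j := by simp [hy, hj.2]
      have : (fun i => if i ∈ insert a s then x i + c i • x j else x i) =
          Function.update y a (y a + c a • y j) := by
        funext i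
        by_cases hi : i = a
        · subst hi; simp [hy, ha, hj.2]
        · simp [hi, hy]
      rw [this, g.map_update_add, g.map_update_smul, g.map_update_self _ (Ne.symm hj.1),
        Function.update_eq_self, smul_zero, add_zero]
  rw [← key (Finset.univ.erase j) (by simp)]
  congr 1
  funext i
  by_cases hi : i = j
  · subst hi; simp [hc]
  · simp [hi]

theorem ιMulti_snoc {R M : Type*} [CommRing R] [AddCommGroup M] [Module R M] {k : ℕ}
    (w : Fin k → M) (x : M) :
    ExteriorAlgebra.ιMulti R (k + 1) (Fin.snoc w x : Fin (k + 1) → M) =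
      ExteriorAlgebra.ιMulti R k w * ExteriorAlgebra.ι R x := by
  rw [ExteriorAlgebra.ιMulti_apply, ExteriorAlgebra.ιMulti_apply, List.ofFn_succ']
  simp

/-- The determinant of the coordinates given by `L` is an alternating map with value 1 on `w`. -/
theorem ιMulti_ne_zero_of_eq_one {R M : Type*} [CommRing R] [Nontrivial R] [AddCommGroup M]
    [Module R M] {k : ℕ} (L : M →ₗ[R] (Fin k → R)) (w : Fin k → M)
    (h : ∀ i j, L (w i) j = (1 : Matrix (Fin k) (Fin k) R) i j) :
    ExteriorAlgebra.ιMulti R k w ≠ 0 := by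
  intro h0
  have := ExteriorAlgebra.liftAlternating_apply_ιMulti
    (Pi.single k ((Matrix.detRowAlternating (R := R) (n := Fin k)).compLinearMap L)) w
  rw [h0, map_zero, Pi.single_eq_same, AlternatingMap.compLinearMap_apply] at this
  have h1 : (fun i => L (w i)) = (1 : Matrix (Fin k) (Fin k) R) := by
    ext i j; exact h i j
  rw [h1] at this
  exact zero_ne_one (this.trans Matrix.det_one)

/-! ### Sources and targets in terms of the frame -/

variable {d : ℕ}

theorem Frame.repr_proj (v : Frame d) (k : ℕ) (x : Fin d → ℝ) (i : Fin d) :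
    v.repr (v.proj k x) i = if (i : ℕ) < k then v.repr x i else 0 := by
  have : (v.coord i).comp (v.proj k) = if (i : ℕ) < k then v.coord i else 0 := by
    refine v.ext fun j => ?_
    simp only [LinearMap.comp_apply, Frame.proj, Module.Basis.constr_basis]
    by_cases hij : j = i
    · subst hij; split_ifs <;> simp
    · split_ifs <;> simp [hij]
  have h := LinearMap.congr_fun this x
  simp only [LinearMap.comp_apply, Module.Basis.coord_apply] at h
  rw [h]
  split_ifs <;> rfl

theorem Frame.mem_subspace (v : Frame d) (k : ℕ) (x : Fin d → ℝ) :
    x ∈ v.subspace k ↔ ∀ i : Fin d, k ≤ i → v.repr x i = 0 := by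
  rw [Frame.subspace, Module.Basis.mem_span_image]
  simp only [Set.subset_def, Finset.mem_coe, Finsupp.mem_support_iff, Set.mem_ofPred_eq]
  refine forall_congr' fun i => ?_
  rw [← not_lt]
  tauto

variable {v : Frame d} {E F : Set (Fin d → ℝ)}

theorem Frame.lift_mem (hF : Set.BijOn (v.proj (dim F)) (lin F) (v.subspace (dim F)))
    {x : Fin d → ℝ} (hx : x ∈ v.subspace (dim F)) : v.lift F x ∈ lin F :=
  Function.invFunOn_mem (hF.surjOn hx)

theorem Frame.proj_lift (hF : Set.BijOn (v.proj (dim F)) (lin F) (v.subspace (dim F)))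
    {x : Fin d → ℝ} (hx : x ∈ v.subspace (dim F)) : v.proj (dim F) (v.lift F x) = x :=
  Function.invFunOn_eq (hF.surjOn hx)

theorem Frame.repr_lift (hF : Set.BijOn (v.proj (dim F)) (lin F) (v.subspace (dim F)))
    {x : Fin d → ℝ} (hx : x ∈ v.subspace (dim F)) {i : Fin d} (hi : (i : ℕ) < dim F) :
    v.repr (v.lift F x) i = v.repr x i := by
  conv_rhs => rw [← Frame.proj_lift hF hx, Frame.repr_proj, if_pos hi]

theorem Frame.eq_of_repr_eq (hF : Set.BijOn (v.proj (dim F)) (lin F) (v.subspace (dim F)))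
    {x y : Fin d → ℝ} (hx : x ∈ lin F) (hy : y ∈ lin F)
    (h : ∀ i : Fin d, (i : ℕ) < dim F → v.repr x i = v.repr y i) : x = y := by
  refine hF.injOn hx hy (v.repr.injective (Finsupp.ext fun i => ?_))
  rw [Frame.repr_proj, Frame.repr_proj]
  split_ifs with hi
  · exact h i hi
  · rfl

theorem Frame.basis_mem_subspace (v : Frame d) {k : ℕ} {i : Fin d} (hi : (i : ℕ) < k) :
    v i ∈ v.subspace k := Submodule.subset_span ⟨i, hi, rfl⟩

theorem Frame.orientation_eq (v : Frame d) {k : ℕ} (hk : k ≤ d) (h : dim F = k) :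
    v.orientation F = ExteriorAlgebra.ιMulti ℝ k fun i => v.lift F (v (Fin.castLE hk i)) := by
  subst h; rfl

theorem Frame.orientation_ne_zero
    (hF : Set.BijOn (v.proj (dim F)) (lin F) (v.subspace (dim F))) : v.orientation F ≠ 0 := by
  refine ιMulti_ne_zero_of_eq_one
    (LinearMap.pi fun j : Fin (dim F) => v.coord (Fin.castLE (dim_le F) j)) _ fun i j => ?_
  rw [LinearMap.pi_apply, Module.Basis.coord_apply,
    Frame.repr_lift hF (v.basis_mem_subspace (by simp)) (by simp)]
  simp [Finsupp.single_apply, Matrix.one_apply]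

variable {k : ℕ}

/-- If `E` has codimension one in `F`, then `Lin F` is spanned by `Lin E` and the lift of the last
frame vector. -/
theorem Frame.exists_sub_smul_lift_mem
    (hF : Set.BijOn (v.proj (dim F)) (lin F) (v.subspace (dim F)))
    (hE : Set.BijOn (v.proj (dim E)) (lin E) (v.subspace (dim E)))
    (hEF : lin E ≤ lin F) (hk : k < d) (hkF : dim F = k + 1) (hkE : dim E = k)
    {x : Fin d → ℝ} (hx : x ∈ lin F) : ∃ a : ℝ, x - a • v.lift F (v ⟨k, hk⟩) ∈ lin E := by
  have hp : v.proj k x ∈ v.subspace (dim E) := by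
    rw [Frame.mem_subspace]
    intro i hi
    rw [Frame.repr_proj, if_neg (by omega)]
  -- The vector `y` is the part of `x` along `E`. The first k coordinates of `x - y` vanish, so in
  -- Lin F it is a multiple of the lift of the last frame vector.
  set y := v.lift E (v.proj k x)
  have hy : y ∈ lin E := Frame.lift_mem hE hp
  have hv : v ⟨k, hk⟩ ∈ v.subspace (dim F) := v.basis_mem_subspace (by simp [hkF])
  refine ⟨v.repr x ⟨k, hk⟩ - v.repr y ⟨k, hk⟩, ?_⟩
  convert hy using 1
  rw [sub_eq_iff_eq_add]
  refine Frame.eq_of_repr_eq hF hx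
    (add_mem (hEF hy) (Submodule.smul_mem _ _ (Frame.lift_mem hF hv))) fun i hi => ?_
  rw [map_add, map_smul, Finsupp.add_apply, Finsupp.smul_apply, Frame.repr_lift hF hv hi]
  by_cases hik : (i : ℕ) = k
  · obtain rfl : i = ⟨k, hk⟩ := Fin.ext hik
    simp
  · have h1 : (⟨k, hk⟩ : Fin d) ≠ i := fun h => hik (by rw [← h])
    have h2 : (i : ℕ) < k := by omega
    rw [Frame.repr_lift hE hp (by omega), Frame.repr_proj, if_pos h2]
    simp [h1]

/-- The lifts of one of the first k frame vectors to Lin E and to Lin F share their first k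
coordinates. They differ by a multiple of the lift of the last vector, which the wedge product
ignores. -/
theorem Frame.orientation_mul_lift
    (hF : Set.BijOn (v.proj (dim F)) (lin F) (v.subspace (dim F)))
    (hE : Set.BijOn (v.proj (dim E)) (lin E) (v.subspace (dim E)))
    (hEF : lin E ≤ lin F) (hk : k < d) (hkF : dim F = k + 1) (hkE : dim E = k) :
    v.orientation E * ExteriorAlgebra.ι ℝ (v.lift F (v ⟨k, hk⟩)) = v.orientation F := by
  have hv : ∀ i : Fin d, (i : ℕ) < k + 1 → v i ∈ v.subspace (dim F) :=
    fun i hi => v.basis_mem_subspace (by omega)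
  have hvE : ∀ i : Fin d, (i : ℕ) < k → v i ∈ v.subspace (dim E) :=
    fun i hi => v.basis_mem_subspace (by omega)
  rw [v.orientation_eq hk.le hkE, v.orientation_eq hk hkF, ← ιMulti_snoc]
  set w : Fin (k + 1) → Fin d → ℝ := fun i => v.lift F (v (Fin.castLE hk i))
  rw [← alternatingMap_add_smul (ExteriorAlgebra.ιMulti ℝ (k + 1)) w
    (fun i => Fin.snoc (α := fun _ => ℝ)
      (fun i => v.repr (v.lift E (v (Fin.castLE hk.le i))) ⟨k, hk⟩) 0 i) (Fin.last k) (by simp)]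
  congr 1
  funext i
  refine Fin.lastCases ?_ (fun i => ?_) i
  · simp only [Fin.snoc_last, zero_smul, add_zero]; rfl
  simp only [Fin.snoc_castSucc]
  have hi := i.2
  refine Frame.eq_of_repr_eq hF (hEF (Frame.lift_mem hE (hvE _ (by simp))))
    (add_mem (Frame.lift_mem hF (hv _ (by simp)))
      (Submodule.smul_mem _ _ (Frame.lift_mem hF (hv _ (by simp))))) fun j hj => ?_
  rw [map_add, map_smul, Finsupp.add_apply, Finsupp.smul_apply,
    Frame.repr_lift hF (hv _ (by simp)) hj, Frame.repr_lift hF (hv _ (by simp)) hj]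
  by_cases hjk : (j : ℕ) = k
  · obtain rfl : j = ⟨k, hk⟩ := Fin.ext hjk
    have h1 : (Fin.castLE hk.le i : Fin d) ≠ ⟨k, hk⟩ := by
      simp [Fin.ext_iff]; omega
    have h2 : (Fin.castLE hk (Fin.last k) : Fin d) = ⟨k, hk⟩ := by simp [Fin.ext_iff]
    simp [h1, h2]
  · have h1 : (Fin.castLE hk (Fin.last k) : Fin d) ≠ j := by
      simp [Fin.ext_iff]; omega
    rw [Frame.repr_lift hE (hvE _ (by simp)) (by omega)]
    simp only [Module.Basis.repr_self, Finsupp.single_apply, h1, if_false, smul_zero, add_zero]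
    rfl

theorem Frame.orientation_mul_eq_zero (hk : k < d) (hkE : dim E = k)
    (hE : Set.BijOn (v.proj (dim E)) (lin E) (v.subspace (dim E))) {y : Fin d → ℝ}
    (hy : y ∈ lin E) : v.orientation E * ExteriorAlgebra.ι ℝ y = 0 := by
  rw [v.orientation_eq hk.le hkE, ← ιMulti_snoc]
  refine AlternatingMap.map_linearDependent _ _ fun hli => ?_
  have hmem : ∀ i, (Fin.snoc (fun i => v.lift E (v (Fin.castLE hk.le i))) y :
      Fin (k + 1) → Fin d → ℝ) i ∈ lin E := by
    intro i
    refine Fin.lastCases ?_ (fun i => ?_) i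
    · simpa using hy
    · simpa using Frame.lift_mem hE (v.basis_mem_subspace (by simp [hkE]))
  have hli' : LinearIndependent ℝ fun i => (⟨_, hmem i⟩ : lin E) :=
    LinearIndependent.of_comp (lin E).subtype hli
  have := hli'.fintype_card_le_finrank
  rw [Fintype.card_fin] at this
  have h2 : Module.finrank ℝ (lin E) = k := hkE
  omega

/-- Modulo Lin E, `x` is `a` times the lift of the last vector, so the wedge product is `a` times
the orientation of `F`, which is nonzero. -/
theorem Frame.orientEquiv_iff
    (hF : Set.BijOn (v.proj (dim F)) (lin F) (v.subspace (dim F)))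
    (hE : Set.BijOn (v.proj (dim E)) (lin E) (v.subspace (dim E)))
    (hEF : lin E ≤ lin F) (hk : k < d) (hkF : dim F = k + 1) (hkE : dim E = k)
    {x : Fin d → ℝ} {a : ℝ} (ha : x - a • v.lift F (v ⟨k, hk⟩) ∈ lin E) :
    OrientEquiv (v.orientation F) (v.orientation E * ExteriorAlgebra.ι ℝ x) ↔ 0 < a := by
  have h1 : v.orientation E * ExteriorAlgebra.ι ℝ x = a • v.orientation F := by
    have h2 := Frame.orientation_mul_eq_zero hk hkE hE ha
    rw [map_sub, map_smul, mul_sub, mul_smul_comm,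
      Frame.orientation_mul_lift hF hE hEF hk hkF hkE, sub_eq_zero] at h2
    exact h2
  have hne := Frame.orientation_ne_zero hF
  rw [h1, OrientEquiv]
  constructor
  · rintro ⟨r, hr, h⟩
    rw [smul_smul] at h
    have h3 : (r * a - 1) • v.orientation F = 0 := by rw [sub_smul, ← h, one_smul, sub_self]
    have h4 := (smul_eq_zero.1 h3).resolve_right hne
    have h5 : 0 < r * a := by linarith
    exact pos_of_mul_pos_right h5 hr.le
  · intro h
    exact ⟨a⁻¹, inv_pos.2 h, by rw [smul_smul, inv_mul_cancel₀ h.ne', one_smul]⟩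

theorem normalCone.eq_zero_of_mem_lin {ψ : StrongDual ℝ (Fin d → ℝ)} (hψ : ψ ∈ normalCone F E)
    {x : Fin d → ℝ} (hx : x ∈ lin E) : ψ x = 0 := by
  have : lin E ≤ LinearMap.ker (ψ : (Fin d → ℝ) →ₗ[ℝ] ℝ) := by
    rw [lin, vectorSpan, Submodule.span_le]
    rintro _ ⟨y, hy, z, hz, rfl⟩
    have hψ' : E = ψ.toExposed F := hψ
    rw [hψ'] at hy hz
    have := le_antisymm (hz.2 y hy.1) (hy.2 z hz.1)
    simp [this]
  exact this hx

/-- A facet `E` of `F` is in the source (target) of `F` if and only if the outer normals are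
negative (positive) on the lift of the last frame vector. -/
theorem Frame.mem_source_target_iff
    (hF : Set.BijOn (v.proj (dim F)) (lin F) (v.subspace (dim F)))
    (hE : Set.BijOn (v.proj (dim E)) (lin E) (v.subspace (dim E)))
    (hk : k < d) (hkF : dim F = k + 1) (hkE : dim E = k) :
    (E ∈ source v.orientation F ↔
      IsFace F E ∧ ∃ ψ ∈ normalCone F E, ψ (v.lift F (v ⟨k, hk⟩)) < 0) ∧
    (E ∈ target v.orientation F ↔
      IsFace F E ∧ ∃ ψ ∈ normalCone F E, 0 < ψ (v.lift F (v ⟨k, hk⟩))) := by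
  have hfacet : IsFacet F E ↔ IsFace F E := by simp [IsFacet, hkF, hkE]
  have hu : v.lift F (v ⟨k, hk⟩) ∈ lin F :=
    Frame.lift_mem hF (v.basis_mem_subspace (by simp [hkF]))
  rw [source, target, Set.mem_ofPred_eq, Set.mem_ofPred_eq, hfacet]
  refine ⟨and_congr_right fun hface => ?_, and_congr_right fun hface => ?_⟩ <;>
  · have hEF : lin E ≤ lin F := vectorSpan_mono ℝ hface.1.subset
    have hiff := fun {x a} => Frame.orientEquiv_iff (x := x) (a := a) hF hE hEF hk hkF hkE
    constructor
    · rintro ⟨x, hx, ψ, hψ, hneg, hor⟩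
      obtain ⟨a, ha⟩ := Frame.exists_sub_smul_lift_mem hF hE hEF hk hkF hkE hx
      have h0 := normalCone.eq_zero_of_mem_lin hψ ha
      rw [map_sub, map_smul, sub_eq_zero, smul_eq_mul] at h0
      have hpos := (hiff ha).1 hor
      rw [h0] at hneg
      exact ⟨ψ, hψ, by simpa [hpos, mul_neg_iff, mul_pos_iff, hpos.not_gt] using hneg⟩
    · rintro ⟨ψ, hψ, hneg⟩
      exact ⟨_, hu, ψ, hψ, hneg, (hiff (a := 1) (by simp)).2 one_pos⟩

open Polynomial

/-! ### Faces of convex hulls of finite families -/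

section Hull

variable {d : ℕ} {ι : Type*} (x : ι → Fin d → ℝ)

/-- The convex hull of the points of a family with indices in `I`. -/
def hull (I : Finset ι) : Set (Fin d → ℝ) := convexHull ℝ (x '' I)

variable {x}

theorem hull_mono {J I : Finset ι} (h : J ⊆ I) : hull x J ⊆ hull x I :=
  convexHull_mono (Set.image_mono h)

theorem mem_hull {I : Finset ι} {i : ι} (h : i ∈ I) : x i ∈ hull x I :=
  subset_convexHull _ _ ⟨i, h, rfl⟩

theorem hull_le {I : Finset ι} {ψ : StrongDual ℝ (Fin d → ℝ)} {c : ℝ}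
    (h : ∀ i ∈ I, ψ (x i) ≤ c) {y : Fin d → ℝ} (hy : y ∈ hull x I) : ψ y ≤ c := by
  refine convexHull_min (t := {y | ψ y ≤ c}) ?_ ?_ hy
  · rintro _ ⟨i, hi, rfl⟩; exact h i hi
  · exact convex_halfSpace_le ψ.toLinearMap.isLinear c

theorem hull_eq {J : Finset ι} {ψ : StrongDual ℝ (Fin d → ℝ)} {c : ℝ}
    (h : ∀ i ∈ J, ψ (x i) = c) {y : Fin d → ℝ} (hy : y ∈ hull x J) : ψ y = c := by
  refine le_antisymm (hull_le (fun i hi => (h i hi).le) hy) ?_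
  have := hull_le (ψ := -ψ) (c := -c) (fun i hi => by simp [h i hi]) hy
  simpa using this

/-- The locus where a functional is maximal on the hull of a family is spanned by the members of
the family where it is maximal. -/
theorem toExposed_hull {J I : Finset ι} (hJI : J ⊆ I) (hJ : J.Nonempty)
    {ψ : StrongDual ℝ (Fin d → ℝ)} {c : ℝ} (h : ∀ i ∈ J, ψ (x i) = c)
    (h' : ∀ i ∈ I, i ∉ J → ψ (x i) < c) : ψ.toExposed (hull x I) = hull x J := by
  have hle : ∀ i ∈ I, ψ (x i) ≤ c := fun i hi =>
    (em (i ∈ J)).elim (fun hi' => (h i hi').le) fun hi' => (h' i hi hi').le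
  ext y
  constructor
  · rintro ⟨hy, hmax⟩
    obtain ⟨j, hj⟩ := hJ
    have hyc : c ≤ ψ y := (h j hj).symm.le.trans (hmax _ (mem_hull (hJI hj)))
    -- The union of the open half-space and the hull of `J` is convex and contains all the points,
    -- hence their hull. A maximizer is not in the half-space.
    have hsub : hull x I ⊆ {y | ψ y < c} ∪ hull x J := by
      refine convexHull_min ?_ ?_
      · rintro _ ⟨i, hi, rfl⟩
        by_cases hi' : i ∈ J
        · exact Or.inr (mem_hull hi')
        · exact Or.inl (h' i hi hi')
      · rw [convex_iff_forall_pos]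
        intro a ha b hb α β hα hβ hαβ
        have hc : c = α * c + β * c := by rw [← add_mul, hαβ, one_mul]
        have hlin : ψ (α • a + β • b) = α * ψ a + β * ψ b := by simp
        have hle' : ∀ z ∈ {y | ψ y < c} ∪ hull x J, ψ z ≤ c := by
          rintro z (hz | hz)
          · exact le_of_lt hz
          · exact (hull_eq h hz).le
        rcases ha with ha' | ha'
        · left
          have h1 : ψ a < c := ha'
          have h2 := hle' b hb
          change ψ _ < c
          rw [hlin]
          nlinarith [mul_lt_mul_of_pos_left h1 hα, mul_le_mul_of_nonneg_left h2 hβ.le]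
        · rcases hb with hb' | hb'
          · left
            have h1 : ψ b < c := hb'
            have h2 := (hull_eq h ha').le
            change ψ _ < c
            rw [hlin]
            nlinarith [mul_lt_mul_of_pos_left h1 hβ, mul_le_mul_of_nonneg_left h2 hα.le]
          · right
            exact convex_convexHull ℝ _ ha' hb' hα.le hβ.le hαβ
    rcases hsub hy with h1 | h1
    · exact absurd hyc (not_le.2 h1)
    · exact h1
  · intro hy
    exact ⟨hull_mono hJI hy, fun z hz => (hull_le hle hz).trans (hull_eq h hy).symm.le⟩

theorem isFace_hull {J I : Finset ι} (hJI : J ⊆ I) (hJ : J.Nonempty)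
    {ψ : StrongDual ℝ (Fin d → ℝ)} {c : ℝ} (h : ∀ i ∈ J, ψ (x i) = c)
    (h' : ∀ i ∈ I, i ∉ J → ψ (x i) < c) : IsFace (hull x I) (hull x J) := by
  refine ⟨fun _ => ⟨ψ, (toExposed_hull hJI hJ h h').symm⟩, ?_⟩
  obtain ⟨j, hj⟩ := hJ
  exact ⟨_, mem_hull hj⟩

theorem exists_of_mem_normalCone {I : Finset ι} (hI : I.Nonempty) {F : Set (Fin d → ℝ)}
    {ψ : StrongDual ℝ (Fin d → ℝ)} (hψ : ψ ∈ normalCone (hull x I) F) :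
    ∃ J ⊆ I, ∃ c, J.Nonempty ∧ F = hull x J ∧ (∀ i ∈ J, ψ (x i) = c) ∧
      ∀ i ∈ I, i ∉ J → ψ (x i) < c := by
  classical
  obtain ⟨m, hm, hmax⟩ := Finset.exists_max_image I (fun i => ψ (x i)) hI
  have h : ∀ i ∈ I.filter (fun i => ψ (x i) = ψ (x m)), ψ (x i) = ψ (x m) :=
    fun i hi => (Finset.mem_filter.1 hi).2
  have h' : ∀ i ∈ I, i ∉ I.filter (fun i => ψ (x i) = ψ (x m)) → ψ (x i) < ψ (x m) :=
    fun i hi hi' => lt_of_le_of_ne (hmax i hi) fun he => hi' (Finset.mem_filter.2 ⟨hi, he⟩)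
  have hne : (I.filter fun i => ψ (x i) = ψ (x m)).Nonempty := ⟨m, by simp [hm]⟩
  refine ⟨_, Finset.filter_subset _ _, ψ (x m), hne, ?_, h, h'⟩
  rw [← toExposed_hull (Finset.filter_subset _ _) hne h h']
  exact hψ

theorem IsFace.exists_normal {P F : Set (Fin d → ℝ)} (h : IsFace P F) : ∃ ψ, ψ ∈ normalCone P F :=
  h.1 h.2

theorem mem_hull_iff {J I : Finset ι} {ψ : StrongDual ℝ (Fin d → ℝ)} {c : ℝ}
    (h : ∀ i ∈ J, ψ (x i) = c) (h' : ∀ i ∈ I, i ∉ J → ψ (x i) < c) {i : ι} (hi : i ∈ I) :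
    x i ∈ hull x J ↔ i ∈ J :=
  ⟨fun hm => by_contra fun hJ => (h' i hi hJ).ne (hull_eq h hm), mem_hull⟩

theorem finrank_lin_hull_le [DecidableEq ι] {I : Finset ι} {k : ℕ} (hI : I.card = k + 1) :
    dim (hull x I) ≤ k := by
  have : lin (hull x I) = vectorSpan ℝ (Finset.image x I : Set (Fin d → ℝ)) := by
    rw [lin, hull, ← direction_affineSpan, affineSpan_convexHull, direction_affineSpan,
      Finset.coe_image]
  rw [dim, this]
  exact finrank_vectorSpan_image_finset_le ℝ x I hI

end Hull

/-! ### Polynomials and the moment curve -/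

/-- The functional on `ℝ^d` with coefficients those of a polynomial of degree at most `d`, up to
the constant coefficient. -/
def polyFunctional (d : ℕ) (p : ℝ[X]) : StrongDual ℝ (Fin d → ℝ) :=
  ∑ i : Fin d, p.coeff (i + 1) • ContinuousLinearMap.proj (R := ℝ) (φ := fun _ : Fin d => ℝ) i

theorem polyFunctional_apply (d : ℕ) (p : ℝ[X]) (x : Fin d → ℝ) :
    polyFunctional d p x = ∑ i : Fin d, p.coeff (i + 1) * x i := by
  simp [polyFunctional]

theorem polyFunctional_momentCurve {d : ℕ} {p : ℝ[X]} (hp : p.natDegree ≤ d) (s : ℝ) :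
    polyFunctional d p (momentCurve d s) = p.eval s - p.coeff 0 := by
  rw [polyFunctional_apply, eval_eq_sum_range' (Nat.lt_succ_of_le hp), Finset.sum_range_succ',
    Finset.sum_range]
  simp [momentCurve]

/-- A polynomial of degree at most `d` representing a functional on the moment curve. -/
theorem exists_poly_of_functional {d : ℕ} (ψ : (Fin d → ℝ) →ₗ[ℝ] ℝ) :
    ∃ p : ℝ[X], p.natDegree ≤ d ∧ (∀ s, p.eval s = ψ (momentCurve d s)) ∧
      ∀ i : Fin d, p.coeff (i + 1) = ψ (Pi.single i 1) := by
  refine ⟨∑ i : Fin d, C (ψ (Pi.single i 1)) * X ^ ((i : ℕ) + 1), ?_, ?_, ?_⟩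
  · refine natDegree_sum_le_of_forall_le _ _ fun i _ => ?_
    exact (natDegree_C_mul_X_pow_le _ _).trans i.2
  · intro s
    rw [eval_finsetSum, LinearMap.pi_apply_eq_sum_univ ψ]
    refine Finset.sum_congr rfl fun i _ => ?_
    simp only [eval_mul, eval_C, eval_pow, eval_X, momentCurve, smul_eq_mul, mul_comm]
    congr 2
    funext j
    simp [Pi.single_apply, eq_comm]
  · intro i
    rw [finsetSum_coeff, Finset.sum_eq_single i]
    · simp
    · intro j _ hj
      rw [coeff_C_mul_X_pow, if_neg fun h => hj (Fin.ext (by omega))]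
    · simp

/-- A functional which is constant on more than `d` points of the moment curve vanishes. -/
theorem functional_eq_zero_of_momentCurve {d : ℕ} {ι : Type*} {t : ι → ℝ}
    (ht : Function.Injective t) {I : Finset ι} (hI : d < I.card) (ψ : (Fin d → ℝ) →ₗ[ℝ] ℝ) (c : ℝ)
    (h : ∀ i ∈ I, ψ (momentCurve d (t i)) = c) : ψ = 0 := by
  classical
  obtain ⟨p, hdeg, heval, hcoeff⟩ := exists_poly_of_functional ψ
  have hz : p - C c = 0 := by
    refine eq_zero_of_natDegree_lt_card_of_eval_eq_zero' _ (I.image t) ?_ ?_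
    · intro s hs
      obtain ⟨i, hi, rfl⟩ := Finset.mem_image.1 hs
      simp [heval, h i hi]
    · rw [Finset.card_image_of_injective _ ht]
      exact ((natDegree_sub_C).le.trans hdeg).trans_lt hI
  rw [sub_eq_zero] at hz
  refine LinearMap.pi_ext' fun i => LinearMap.ext_ring ?_
  have := hcoeff i
  rw [hz, coeff_C_succ] at this
  simpa using this.symm

section Moment

variable {d : ℕ} {ι : Type*} {t : ι → ℝ}

/-- The first coordinates of `ℝ^d`. -/
def restrictCoords {k d : ℕ} (hk : k ≤ d) : (Fin d → ℝ) →ₗ[ℝ] (Fin k → ℝ) :=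
  LinearMap.funLeft ℝ ℝ (Fin.castLE hk)

/-- Otherwise a nonzero functional on ℝ^k kills the image. Truncating the moment curve of ℝ^d gives
that of ℝ^k, so the functional would be constant on more than k points of the latter. -/
theorem restrictCoords_surjective (ht : Function.Injective t) {k : ℕ} (hk : k ≤ d) {I : Finset ι}
    (hI : k < I.card) : Function.Surjective ((restrictCoords hk).domRestrict
      (lin (hull (fun i => momentCurve d (t i)) I))) := by
  rw [← LinearMap.range_eq_top]
  by_contra hne
  obtain ⟨g, hg, hker⟩ := Submodule.exists_le_ker_of_lt_top _ (lt_top_iff_ne_top.2 hne)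
  obtain ⟨j, hj⟩ := Finset.card_pos.1 ((Nat.zero_le k).trans_lt hI)
  refine hg (functional_eq_zero_of_momentCurve ht hI g (g (momentCurve k (t j))) fun i hi => ?_)
  have hmem : momentCurve d (t i) - momentCurve d (t j) ∈
      lin (hull (fun i => momentCurve d (t i)) I) :=
    vsub_mem_vectorSpan ℝ (mem_hull (x := fun i => momentCurve d (t i)) hi)
      (mem_hull (x := fun i => momentCurve d (t i)) hj)
  have : g (restrictCoords hk (momentCurve d (t i) - momentCurve d (t j))) = 0 :=
    hker ⟨⟨_, hmem⟩, rfl⟩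
  rwa [map_sub, map_sub, sub_eq_zero] at this

theorem le_dim_hull (ht : Function.Injective t) {k : ℕ} (hk : k ≤ d) {I : Finset ι}
    (hI : k < I.card) : k ≤ dim (hull (fun i => momentCurve d (t i)) I) := by
  have := LinearMap.finrank_le_finrank_of_surjective (restrictCoords_surjective ht hk hI)
  simpa [dim] using this

theorem dim_hull_of_card (ht : Function.Injective t) {k : ℕ} (hk : k ≤ d) {I : Finset ι}
    (hI : I.card = k + 1) : dim (hull (fun i => momentCurve d (t i)) I) = k := by
  classical
  exact le_antisymm (finrank_lin_hull_le hI) (le_dim_hull ht hk (by omega))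

theorem dim_hull_of_lt (ht : Function.Injective t) {I : Finset ι} (hI : d < I.card) :
    dim (hull (fun i => momentCurve d (t i)) I) = d :=
  le_antisymm (dim_le _) (le_dim_hull ht le_rfl hI)

theorem dim_hull_lt_card {I : Finset ι} (hI : I.Nonempty) :
    dim (hull (fun i => momentCurve d (t i)) I) < I.card := by
  classical
  have := Finset.card_pos.2 hI
  have := finrank_lin_hull_le (x := fun i => momentCurve d (t i)) (I := I) (k := I.card - 1)
    (by omega)
  omega

/-! ### Diagonal frames -/

variable {v : Frame d} {s : Fin d → ℝ}

theorem repr_mul_of_diagonal (hv : ∀ i, v i = Pi.single i (s i)) (x : Fin d → ℝ) (i : Fin d) :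
    v.repr x i * s i = x i := by
  conv_rhs => rw [← v.sum_repr x]
  rw [Finset.sum_apply, Finset.sum_eq_single i] <;> simp +contextual [hv, eq_comm]

theorem ne_zero_of_diagonal (hv : ∀ i, v i = Pi.single i (s i)) (i : Fin d) : s i ≠ 0 := by
  intro h
  exact v.ne_zero i (by rw [hv, h, Pi.single_zero])

theorem proj_apply_of_diagonal (hv : ∀ i, v i = Pi.single i (s i)) (k : ℕ) (x : Fin d → ℝ)
    (i : Fin d) : v.proj k x i = if (i : ℕ) < k then x i else 0 := by
  rw [← repr_mul_of_diagonal hv (v.proj k x), Frame.repr_proj]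
  split_ifs
  · exact repr_mul_of_diagonal hv x i
  · simp

theorem mem_subspace_of_diagonal (hv : ∀ i, v i = Pi.single i (s i)) (k : ℕ) (x : Fin d → ℝ) :
    x ∈ v.subspace k ↔ ∀ i : Fin d, k ≤ i → x i = 0 := by
  rw [Frame.mem_subspace]
  refine forall_congr' fun i => forall_congr' fun _ => ?_
  rw [← repr_mul_of_diagonal hv x i]
  simp [ne_zero_of_diagonal hv i]

/-- For a diagonal frame the projection is truncation of coordinates. It is onto because `I` has
more elements than the dimension of its hull, and then injective by equality of dimensions. -/
theorem bijOn_proj_hull (hv : ∀ i, v i = Pi.single i (s i)) (ht : Function.Injective t)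
    {I : Finset ι} (hI : I.Nonempty) :
    Set.BijOn (v.proj (dim (hull (fun i => momentCurve d (t i)) I)))
      (lin (hull (fun i => momentCurve d (t i)) I))
      (v.subspace (dim (hull (fun i => momentCurve d (t i)) I))) := by
  set F := hull (fun i => momentCurve d (t i)) I with hFdef
  have hk := dim_le F
  have hsurj := restrictCoords_surjective ht hk (dim_hull_lt_card hI)
  have hinj := (LinearMap.injective_iff_surjective_of_finrank_eq_finrank
    (by rw [Module.finrank_fin_fun]; rfl)).2 hsurj
  refine ⟨fun x _ => ?_, fun x hx y hy hxy => ?_, fun y hy => ?_⟩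
  · rw [SetLike.mem_coe, mem_subspace_of_diagonal hv]
    intro i hi
    rw [proj_apply_of_diagonal hv, if_neg hi.not_gt]
  · have : (⟨x, hx⟩ : lin F) = ⟨y, hy⟩ := by
      refine hinj (funext fun j => ?_)
      have := congrFun hxy (Fin.castLE hk j)
      rw [proj_apply_of_diagonal hv, proj_apply_of_diagonal hv, if_pos (by simp),
        if_pos (by simp)] at this
      exact this
    exact congrArg Subtype.val this
  · obtain ⟨⟨x, hx⟩, hxy⟩ := hsurj (restrictCoords hk y)
    refine ⟨x, hx, funext fun i => ?_⟩
    rw [proj_apply_of_diagonal hv]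
    split_ifs with hi
    · exact congrFun hxy ⟨i, hi⟩
    · exact ((mem_subspace_of_diagonal hv _ _).1 hy i (not_lt.1 hi)).symm

end Moment

/-! ### The faces of cyclic polytopes -/

section Cyclic

variable {n d : ℕ} {t : Fin n → ℝ}

/-- The convex hull of the points of the moment curve with parameters `t i`, `i ∈ I`. -/
abbrev momentHull (d : ℕ) (t : Fin n → ℝ) (I : Finset (Fin n)) : Set (Fin d → ℝ) :=
  hull (fun i => momentCurve d (t i)) I

theorem cyclicPolytope_eq : cyclicPolytope d t = momentHull d t Finset.univ := by
  simp [cyclicPolytope, hull]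

open scoped Classical in
/-- The indices of the points `ν(t_i)` contained in a set. -/
def vertexSet (t : Fin n → ℝ) (F : Set (Fin d → ℝ)) : Finset (Fin n) :=
  Finset.univ.filter fun i => momentCurve d (t i) ∈ F

theorem mem_vertexSet {F : Set (Fin d → ℝ)} {i : Fin n} :
    i ∈ vertexSet t F ↔ momentCurve d (t i) ∈ F := by
  simp [vertexSet]

/-- `I` is cut out by a supporting hyperplane of the cyclic polytope. -/
def IsFaceSet (d : ℕ) (t : Fin n → ℝ) (I : Finset (Fin n)) : Prop :=
  I.Nonempty ∧ ∃ p : ℝ[X], p.natDegree ≤ d ∧ (∀ i ∈ I, p.eval (t i) = 0) ∧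
    ∀ i, i ∉ I → p.eval (t i) < 0

theorem polyFunctional_exposes {p : ℝ[X]} (hp : p.natDegree ≤ d) {J I : Finset (Fin n)}
    (h : ∀ i ∈ J, p.eval (t i) = 0) (h' : ∀ i ∈ I, i ∉ J → p.eval (t i) < 0) :
    (∀ i ∈ J, polyFunctional d p (momentCurve d (t i)) = -p.coeff 0) ∧
      ∀ i ∈ I, i ∉ J → polyFunctional d p (momentCurve d (t i)) < -p.coeff 0 := by
  refine ⟨fun i hi => ?_, fun i hi hi' => ?_⟩
  · rw [polyFunctional_momentCurve hp, h i hi, zero_sub]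
  · rw [polyFunctional_momentCurve hp]
    linarith [h' i hi hi']

theorem IsFaceSet.isFace {I : Finset (Fin n)} (h : IsFaceSet d t I) :
    IsFace (cyclicPolytope d t) (momentHull d t I) ∧ vertexSet t (momentHull d t I) = I := by
  obtain ⟨hne, p, hp, hI, hI'⟩ := h
  obtain ⟨h1, h2⟩ := polyFunctional_exposes (I := Finset.univ) hp hI fun i _ => hI' i
  rw [cyclicPolytope_eq]
  refine ⟨isFace_hull (Finset.subset_univ _) hne h1 h2, ?_⟩
  ext i
  rw [mem_vertexSet]
  exact mem_hull_iff (x := fun i => momentCurve d (t i)) h1 h2 (Finset.mem_univ i)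

theorem vertexSet_of_isFace_hull {I : Finset (Fin n)} {F : Set (Fin d → ℝ)} (hI : I.Nonempty)
    {ψ : StrongDual ℝ (Fin d → ℝ)} (hψ : ψ ∈ normalCone (momentHull d t I) F)
    (hsub : vertexSet t F ⊆ I) :
    (vertexSet t F).Nonempty ∧ F = momentHull d t (vertexSet t F) ∧
      ∃ c, (∀ i ∈ vertexSet t F, ψ (momentCurve d (t i)) = c) ∧
        ∀ i ∈ I, i ∉ vertexSet t F → ψ (momentCurve d (t i)) < c := by
  obtain ⟨J, hJI, c, hJ, hF, h, h'⟩ := exists_of_mem_normalCone hI hψ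
  have : vertexSet t F = J := by
    ext i
    refine ⟨fun hi => ?_, fun hi => ?_⟩
    · have h1 := mem_vertexSet.1 hi
      rw [hF] at h1
      exact (mem_hull_iff (x := fun i => momentCurve d (t i)) h h' (hsub hi)).1 h1
    · rw [mem_vertexSet, hF]
      exact mem_hull (x := fun i => momentCurve d (t i)) hi
  rw [this]
  exact ⟨hJ, hF, c, h, h'⟩

theorem univ_nonempty (hn : d < n) : (Finset.univ : Finset (Fin n)).Nonempty :=
  ⟨⟨0, by omega⟩, Finset.mem_univ _⟩

theorem isFaceSet_vertexSet (hn : d < n) {F : Set (Fin d → ℝ)} (hF : IsFace (cyclicPolytope d t) F) :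
    IsFaceSet d t (vertexSet t F) ∧ F = momentHull d t (vertexSet t F) := by
  obtain ⟨ψ, hψ⟩ := hF.exists_normal
  rw [cyclicPolytope_eq] at hψ
  obtain ⟨hne, hFeq, c, h, h'⟩ := vertexSet_of_isFace_hull (univ_nonempty hn) hψ
    (Finset.subset_univ _)
  obtain ⟨p, hdeg, heval, -⟩ := exists_poly_of_functional ψ.toLinearMap
  refine ⟨⟨hne, p - C c, natDegree_sub_C.le.trans hdeg, fun i hi => ?_, fun i hi => ?_⟩, hFeq⟩
  · have := h i hi
    simp [heval, this]
  · have := h' i (Finset.mem_univ i) hi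
    simp [heval, this]

/-- More than d roots force the supporting polynomial to be zero, and then it is negative nowhere.
-/
theorem IsFaceSet.card_le_or_eq_univ (ht : Function.Injective t) {I : Finset (Fin n)}
    (h : IsFaceSet d t I) : I.card ≤ d ∨ I = Finset.univ := by
  obtain ⟨-, p, hp, hI, hI'⟩ := h
  by_contra! hcon
  have hz : p = 0 := by
    refine eq_zero_of_natDegree_lt_card_of_eval_eq_zero' _ (I.image t) ?_ ?_
    · intro s hs
      obtain ⟨i, hi, rfl⟩ := Finset.mem_image.1 hs
      exact hI i hi
    · rw [Finset.card_image_of_injective _ ht]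
      omega
  refine hcon.2 (Finset.eq_univ_iff_forall.2 fun i => by_contra fun hi => ?_)
  have := hI' i hi
  simp [hz] at this

theorem IsFaceSet.dim_cases (ht : Function.Injective t) (hn : d < n) {I : Finset (Fin n)}
    (h : IsFaceSet d t I) :
    (dim (momentHull d t I) < d ∧ I.card = dim (momentHull d t I) + 1) ∨
      (dim (momentHull d t I) = d ∧ I = Finset.univ) := by
  rcases h.card_le_or_eq_univ ht with hc | rfl
  · left
    have := Finset.card_pos.2 h.1
    rw [dim_hull_of_card ht (k := I.card - 1) (by omega) (by omega)]
    omega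
  · exact Or.inr ⟨dim_hull_of_lt ht (by simpa using hn), rfl⟩

theorem admissible_cyclicPolytope {v : Frame d} {s : Fin d → ℝ} (hv : ∀ i, v i = Pi.single i (s i))
    (ht : Function.Injective t) (hn : d < n) : v.Admissible (cyclicPolytope d t) := by
  intro F hF
  obtain ⟨hI, hFI⟩ := isFaceSet_vertexSet hn hF
  rw [hFI]
  exact bijOn_proj_hull hv ht hI.1

/-! ### Sources and targets in cyclic polytopes -/

/-- The monic polynomial whose roots are the parameters with index in `J`. -/
def rootPoly (t : Fin n → ℝ) (J : Finset (Fin n)) : ℝ[X] := ∏ j ∈ J, (X - C (t j))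

theorem natDegree_rootPoly (J : Finset (Fin n)) : (rootPoly t J).natDegree = J.card :=
  natDegree_finsetProd_X_sub_C_eq_card J t

theorem coeff_rootPoly_card (J : Finset (Fin n)) : (rootPoly t J).coeff J.card = 1 := by
  have h : (rootPoly t J).Monic := monic_prod_of_monic _ _ fun j _ => monic_X_sub_C (t j)
  rw [← natDegree_rootPoly (t := t) J]
  exact h

theorem eval_rootPoly (J : Finset (Fin n)) (r : ℝ) :
    (rootPoly t J).eval r = ∏ j ∈ J, (r - t j) := by
  simp [rootPoly, eval_prod]

theorem eval_rootPoly_of_mem {J : Finset (Fin n)} {i : Fin n} (hi : i ∈ J) :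
    (rootPoly t J).eval (t i) = 0 := by
  rw [eval_rootPoly]
  exact Finset.prod_eq_zero hi (sub_self _)

/-- Only the leading term survives: `u` has no coordinates before k, and the polynomial is monic of
degree k + 1. -/
theorem polyFunctional_rootPoly {k : ℕ} (hk : k < d) {J : Finset (Fin n)} (hJ : J.card = k + 1)
    {u : Fin d → ℝ} (hu : ∀ i : Fin d, (i : ℕ) < k → u i = 0) :
    polyFunctional d (rootPoly t J) u = u ⟨k, hk⟩ := by
  rw [polyFunctional_apply, Finset.sum_eq_single ⟨k, hk⟩]
  · simp only
    rw [← hJ, coeff_rootPoly_card, one_mul]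
  · intro i _ hi
    rcases lt_or_ge (i : ℕ) k with h | h
    · rw [hu i h, mul_zero]
    · have : (i : ℕ) ≠ k := fun h' => hi (Fin.ext h')
      rw [coeff_eq_zero_of_natDegree_lt, zero_mul]
      rw [natDegree_rootPoly]
      omega
  · simp

variable {v : Frame d} {s : Fin d → ℝ}

theorem lift_apply_of_diagonal (hv : ∀ i, v i = Pi.single i (s i)) {F : Set (Fin d → ℝ)} {k : ℕ}
    (hk : k < d) (hkF : dim F = k + 1)
    (hF : Set.BijOn (v.proj (dim F)) (lin F) (v.subspace (dim F))) {i : Fin d} (hi : (i : ℕ) ≤ k) :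
    v.lift F (v ⟨k, hk⟩) i = if (i : ℕ) = k then s i else 0 := by
  have hmem : v ⟨k, hk⟩ ∈ v.subspace (dim F) := v.basis_mem_subspace (by simp [hkF])
  have h := congrFun (Frame.proj_lift hF hmem) i
  rw [proj_apply_of_diagonal hv, if_pos (by omega)] at h
  rw [h, hv, Pi.single_apply]
  by_cases hik : (i : ℕ) = k
  · have : i = ⟨k, hk⟩ := Fin.ext hik
    subst this; simp
  · rw [if_neg hik, if_neg fun h => hik (by rw [h])]

/-- A face of codimension one in `F` lies in the source (target) of `F` if and only if the monic
polynomial with roots at its vertices has the sign of the last frame vector (the opposite sign) at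
all other vertices of `F`. -/
theorem mem_source_target_cyclic_iff (hv : ∀ i, v i = Pi.single i (s i))
    (ht : Function.Injective t) (hn : d < n) {E F : Set (Fin d → ℝ)} {k : ℕ}
    (hF : IsFace (cyclicPolytope d t) F) (hE : IsFace (cyclicPolytope d t) E) (hk : k < d)
    (hkF : dim F = k + 1) (hkE : dim E = k) :
    (E ∈ source v.orientation F ↔ vertexSet t E ⊆ vertexSet t F ∧
      ∀ i ∈ vertexSet t F, i ∉ vertexSet t E →
        0 < s ⟨k, hk⟩ * (rootPoly t (vertexSet t E)).eval (t i)) ∧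
    (E ∈ target v.orientation F ↔ vertexSet t E ⊆ vertexSet t F ∧
      ∀ i ∈ vertexSet t F, i ∉ vertexSet t E →
        s ⟨k, hk⟩ * (rootPoly t (vertexSet t E)).eval (t i) < 0) := by
  have hFb := admissible_cyclicPolytope hv ht hn F hF
  have hEb := admissible_cyclicPolytope hv ht hn E hE
  obtain ⟨hIf, hFI⟩ := isFaceSet_vertexSet hn hF
  obtain ⟨hJf, hEJ⟩ := isFaceSet_vertexSet hn hE
  have hiff := Frame.mem_source_target_iff hFb hEb hk hkF hkE
  set I := vertexSet t F with hI
  set J := vertexSet t E with hJ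
  set u := v.lift F (v ⟨k, hk⟩) with hu
  have hJcard : J.card = k + 1 := by
    have := hJf.dim_cases ht hn
    rw [← hEJ, hkE] at this
    omega
  have hdeg : (rootPoly t J).natDegree ≤ d := by rw [natDegree_rootPoly]; omega
  have hφu : polyFunctional d (rootPoly t J) u = s ⟨k, hk⟩ := by
    rw [polyFunctional_rootPoly hk hJcard fun i hi => ?_]
    · rw [hu, lift_apply_of_diagonal hv hk hkF hFb le_rfl, if_pos rfl]
    · rw [hu, lift_apply_of_diagonal hv hk hkF hFb hi.le, if_neg hi.ne]
  have hs : 0 < s ⟨k, hk⟩ * s ⟨k, hk⟩ := mul_self_pos.2 (ne_zero_of_diagonal hv _)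
  have hJI : J.card < I.card := by
    have h1 := dim_hull_lt_card (d := d) (t := t) hIf.1
    have h2 : dim (hull (fun i => momentCurve d (t i)) I) = k + 1 :=
      (congrArg dim hFI).symm.trans hkF
    omega
  obtain ⟨i₀, hi₀, hi₀'⟩ := Finset.exists_mem_notMem_of_card_lt_card hJI
  have hEF : IsFace F E → J ⊆ I := fun h i hi =>
    mem_vertexSet.2 (h.1.subset (mem_vertexSet.1 hi))
  -- Let φ be the functional of the root polynomial. Modulo Lin E, the edge vector `x` is `a • u`,
  -- so ψ x = a ψ(u) and φ x = a s_k. The product in question equals s_k² ψ(x), and an outer normal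
  -- satisfies ψ x < 0.
  have cond : IsFace F E → ∀ ψ ∈ normalCone F E, ∀ i ∈ I, i ∉ J →
      ψ u * (s ⟨k, hk⟩ * (rootPoly t J).eval (t i)) < 0 := by
    intro hface ψ hψ i hi hi'
    have hsub := hEF hface
    have hψ' := hψ
    rw [hFI] at hψ'
    obtain ⟨⟨j, hj⟩, -, c, h, h'⟩ := vertexSet_of_isFace_hull hIf.1 hψ' hsub
    set x := momentCurve d (t i) - momentCurve d (t j)
    have hx : x ∈ lin F := vsub_mem_vectorSpan ℝ (mem_vertexSet.1 hi) (mem_vertexSet.1 (hsub hj))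
    obtain ⟨a, ha⟩ := Frame.exists_sub_smul_lift_mem hFb hEb (vectorSpan_mono ℝ hface.1.subset)
      hk hkF hkE hx
    have h1 := normalCone.eq_zero_of_mem_lin hψ ha
    have h2 : polyFunctional d (rootPoly t J) (x - a • u) = 0 := by
      -- The root polynomial is constant on `E`, hence a normal of `E` as a face of itself; this
      -- makes it vanish on Lin E.
      have hnc : polyFunctional d (rootPoly t J) ∈ normalCone E E := by
        rw [hEJ]
        have := polyFunctional_exposes (t := t) (I := J) hdeg (fun i => eval_rootPoly_of_mem)
          (fun i hi hi' => absurd hi hi')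
        exact (toExposed_hull (x := fun i => momentCurve d (t i)) subset_rfl hJf.1
          this.1 this.2).symm
      exact normalCone.eq_zero_of_mem_lin hnc ha
    have hψx : ψ x < 0 := by
      rw [map_sub, h j hj]
      linarith [h' i hi hi']
    have hφx : polyFunctional d (rootPoly t J) x = (rootPoly t J).eval (t i) := by
      rw [map_sub, polyFunctional_momentCurve hdeg, polyFunctional_momentCurve hdeg,
        eval_rootPoly_of_mem hj]
      ring
    rw [map_sub, map_smul, smul_eq_mul, sub_eq_zero] at h1 h2
    rw [h1] at hψx
    rw [← hφx, h2, hφu]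
    nlinarith
  -- Conversely, a multiple of the root polynomial that is negative off `J` is itself an outer
  -- normal. It is used with ε = -s_k for sources and ε = s_k for targets, so that its value on `u`
  -- is -s_k² or s_k².
  have conv : ∀ ε : ℝ, J ⊆ I → (∀ i ∈ I, i ∉ J → ε * (rootPoly t J).eval (t i) < 0) →
      IsFace F E ∧ ∃ ψ ∈ normalCone F E, ψ u = ε * s ⟨k, hk⟩ := by
    intro ε hsub h
    have hx := polyFunctional_exposes (p := rootPoly t J) (t := t) (I := J) hdeg
      (fun i => eval_rootPoly_of_mem) (fun i hi hi' => absurd hi hi')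
    have h1 : ∀ i ∈ J, (ε • polyFunctional d (rootPoly t J)) (momentCurve d (t i)) =
        ε * -(rootPoly t J).coeff 0 := by
      intro i hi
      rw [smul_apply, hx.1 i hi, smul_eq_mul]
    have h2 : ∀ i ∈ I, i ∉ J → (ε • polyFunctional d (rootPoly t J)) (momentCurve d (t i)) <
        ε * -(rootPoly t J).coeff 0 := by
      intro i hi hi'
      rw [smul_apply, polyFunctional_momentCurve hdeg, smul_eq_mul]
      linarith [h i hi hi']
    refine ⟨?_, ε • polyFunctional d (rootPoly t J), ?_, ?_⟩
    · rw [hFI, hEJ]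
      exact isFace_hull (x := fun i => momentCurve d (t i)) hsub hJf.1 h1 h2
    · rw [hFI, hEJ]
      exact (toExposed_hull (x := fun i => momentCurve d (t i)) hsub hJf.1 h1 h2).symm
    · rw [smul_apply, hφu, smul_eq_mul]
  rw [hiff.1, hiff.2]
  refine ⟨⟨?_, ?_⟩, ⟨?_, ?_⟩⟩
  · rintro ⟨hface, ψ, hψ, hneg⟩
    exact ⟨hEF hface, fun i hi hi' => pos_of_mul_neg_right (cond hface ψ hψ i hi hi') hneg.le⟩
  · rintro ⟨hsub, h⟩
    obtain ⟨hface, ψ, hψ, hψu⟩ := conv (-s ⟨k, hk⟩) hsub fun i hi hi' => by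
      linarith [h i hi hi']
    exact ⟨hface, ψ, hψ, by rw [hψu]; linarith⟩
  · rintro ⟨hface, ψ, hψ, hpos⟩
    exact ⟨hEF hface, fun i hi hi' => neg_of_mul_neg_right (cond hface ψ hψ i hi hi') hpos.le⟩
  · rintro ⟨hsub, h⟩
    obtain ⟨hface, ψ, hψ, hψu⟩ := conv (s ⟨k, hk⟩) hsub h
    exact ⟨hface, ψ, hψ, by rw [hψu]; exact hs⟩

/-! ### Signs -/

theorem exists_prod_sub_eq {ι : Type*} {f : ι → ℝ} (hf : Function.Injective f) (J : Finset ι)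
    {i : ι} (hi : i ∉ J) :
    ∃ r : ℝ, 0 < r ∧ ∏ j ∈ J, (f i - f j) = r * (-1) ^ (J.filter fun j => f i < f j).card := by
  classical
  induction J using Finset.induction_on with
  | empty => exact ⟨1, one_pos, by simp⟩
  | insert a J ha ih =>
    rw [Finset.mem_insert, not_or] at hi
    obtain ⟨r, hr, h⟩ := ih hi.2
    rw [Finset.prod_insert ha, h, Finset.filter_insert]
    rcases lt_or_gt_of_ne (fun h => hi.1 (hf h) : f i ≠ f a) with hlt | hlt
    · refine ⟨(f a - f i) * r, mul_pos (sub_pos.2 hlt) hr, ?_⟩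
      rw [if_pos hlt, Finset.card_insert_of_notMem (by simp [ha]), pow_succ]
      ring
    · refine ⟨(f i - f a) * r, mul_pos (sub_pos.2 hlt) hr, ?_⟩
      rw [if_neg hlt.not_gt]
      ring

/-- The signs of the frame vectors `s i • e_i` are such that a source (target) is determined by
even (odd) levels with respect to `f` and `q`. -/
def SignCompatible (t : Fin n → ℝ) (s : Fin d → ℝ) (f : Fin n → ℝ) (q : ℕ) : Prop :=
  ∀ (k : ℕ) (hk : k < d) (J : Finset (Fin n)) (i : Fin n), J.card = k + 1 → i ∉ J →
    ∃ r : ℝ, 0 < r ∧ s ⟨k, hk⟩ * (rootPoly t J).eval (t i) = r * (-1) ^ level f q J i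

theorem signCompatible_canonical (ht : Function.Injective t) :
    SignCompatible (d := d) t (fun _ => 1) t 0 := by
  intro k hk J i _ hi
  obtain ⟨r, hr, h⟩ := exists_prod_sub_eq ht J hi
  exact ⟨r, hr, by rw [one_mul, eval_rootPoly, h, level, add_zero]⟩

/-- Passing from t to -t multiplies the product by (-1)^(k+1). With the frame sign (-1)^k a single
minus sign remains, which is the shift q = 1. -/
theorem signCompatible_alternating (ht : Function.Injective t) :
    SignCompatible (d := d) t (fun i => (-1) ^ (i : ℕ)) (fun i => -t i) 1 := by
  intro k hk J i hJ hi
  obtain ⟨r, hr, h⟩ := exists_prod_sub_eq (f := fun i => -t i) (neg_injective.comp ht) J hi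
  refine ⟨r, hr, ?_⟩
  have : ∏ j ∈ J, (t i - t j) = (-1) ^ (k + 1) * ∏ j ∈ J, (-t i - -t j) := by
    rw [← hJ, ← Finset.prod_const, ← Finset.prod_mul_distrib]
    exact Finset.prod_congr rfl fun j _ => by ring
  rw [eval_rootPoly, this, h, level, pow_succ, pow_succ]
  have h1 : ((-1 : ℝ) ^ k) * (-1) ^ k = 1 := by rw [← mul_pow]; simp
  linear_combination (-r * (-1) ^ (J.filter fun j => -t i < -t j).card) * h1

variable {f : Fin n → ℝ} {q : ℕ}

theorem SignCompatible.sign_iff (h : SignCompatible t s f q) {k : ℕ} (hk : k < d)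
    {J : Finset (Fin n)} {i : Fin n} (hJ : J.card = k + 1) (hi : i ∉ J) :
    (0 < s ⟨k, hk⟩ * (rootPoly t J).eval (t i) ↔ (Odd (level f q J i) ↔ false = true)) ∧
      (s ⟨k, hk⟩ * (rootPoly t J).eval (t i) < 0 ↔ (Odd (level f q J i) ↔ true = true)) := by
  obtain ⟨r, hr, he⟩ := h k hk J i hJ hi
  rw [he]
  by_cases ho : Odd (level f q J i)
  · simp [ho, ho.neg_one_pow, hr, hr.le]
  · simp [ho, (Nat.not_odd_iff_even.1 ho).neg_one_pow, hr, hr.le]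

theorem card_vertexSet (ht : Function.Injective t) (hn : d < n) {E : Set (Fin d → ℝ)}
    (hE : IsFace (cyclicPolytope d t) E) (hk : dim E < d) : (vertexSet t E).card = dim E + 1 := by
  obtain ⟨hJf, hEJ⟩ := isFaceSet_vertexSet hn hE
  have := hJf.dim_cases ht hn
  rw [← hEJ] at this
  omega

theorem mem_source_target_iff_isSection (hv : ∀ i, v i = Pi.single i (s i))
    (ht : Function.Injective t) (hn : d < n) (hs : SignCompatible t s f q) {E F : Set (Fin d → ℝ)}
    (hF : IsFace (cyclicPolytope d t) F) (hE : IsFace (cyclicPolytope d t) E)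
    (hEF : dim E + 1 = dim F) :
    (E ∈ source v.orientation F ↔ IsSection f q false (vertexSet t E) (vertexSet t F)) ∧
      (E ∈ target v.orientation F ↔ IsSection f q true (vertexSet t E) (vertexSet t F)) := by
  have hk : dim E < d := by have := dim_le F; omega
  have hc := card_vertexSet ht hn hE hk
  obtain ⟨h1, h2⟩ := mem_source_target_cyclic_iff hv ht hn hF hE hk hEF.symm rfl
  rw [h1, h2]
  exact ⟨and_congr_right fun _ => forall_congr' fun i => forall_congr' fun _ =>
    forall_congr' fun hi => (hs.sign_iff hk hc hi).1,
    and_congr_right fun _ => forall_congr' fun i => forall_congr' fun _ =>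
    forall_congr' fun hi => (hs.sign_iff hk hc hi).2⟩

/-! ### The vertex model of a cyclic polytope -/

/-- A subset of a face set with at most `d + 1` elements is a face set. -/
theorem IsFaceSet.subset (ht : Function.Injective t) {J I : Finset (Fin n)} (h : IsFaceSet d t I)
    (hI : I.card ≤ d + 1) (hJI : J ⊆ I) (hJ : J.Nonempty) : IsFaceSet d t J := by
  classical
  obtain ⟨-, p, hp, hpI, hpI'⟩ := h
  -- The interpolant vanishes on `J` and is -1 on `I \ J`; at most d + 1 nodes keep its degree at
  -- most d. A small positive multiple, added to `p`, preserves negativity at the finitely many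
  -- nodes outside `I`.
  set r : Fin n → ℝ := fun i => if i ∈ J then 0 else -1 with hr
  set L := Lagrange.interpolate I t r with hL
  have hLdeg : L.natDegree ≤ d := by
    have h1 := Lagrange.degree_interpolate_lt (s := I) (v := t) r ht.injOn
    exact natDegree_le_iff_coeff_eq_zero.2 fun N hN =>
      coeff_eq_zero_of_degree_lt (h1.trans_le (by exact_mod_cast hI.trans hN))
  have hLI : ∀ i ∈ I, L.eval (t i) = r i := fun i hi =>
    Lagrange.eval_interpolate_at_node r ht.injOn hi
  have hev : ∀ᶠ ε : ℝ in nhdsWithin 0 (Set.Ioi 0), ∀ i, i ∉ I →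
      p.eval (t i) + ε * L.eval (t i) < 0 := by
    rw [Filter.eventually_all]
    intro i
    by_cases hi : i ∈ I
    · simp [hi]
    have hc : Continuous fun ε : ℝ => p.eval (t i) + ε * L.eval (t i) := by fun_prop
    have := (hc.tendsto 0).eventually_lt_const (u := 0) (by simpa using hpI' i hi)
    filter_upwards [nhdsWithin_le_nhds this] with ε hε _ using hε
  obtain ⟨ε, hε, hpos⟩ := (hev.and self_mem_nhdsWithin).exists
  have hpos : 0 < ε := hpos
  refine ⟨hJ, p + C ε * L, ?_, fun i hi => ?_, fun i hi => ?_⟩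
  · exact (natDegree_add_le _ _).trans (max_le hp ((natDegree_C_mul_le _ _).trans hLdeg))
  · simp [hpI i (hJI hi), hLI i (hJI hi), hr, hi]
  · by_cases hiI : i ∈ I
    · simp [hpI i hiI, hLI i hiI, hr, hi, hpos]
    · simpa using hε i hiI

/-- The perturbation argument fails for more than d + 1 vertices. Here the parity condition says
that the root polynomial has constant sign off `J`, so up to sign it cuts out `J`. -/
theorem isFaceSet_of_isSection_univ (hs : SignCompatible t s f q) {k : ℕ} (hk : k < d)
    {J : Finset (Fin n)} (hJ : J.card = k + 1) {ε : Bool}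
    (h : IsSection f q ε J Finset.univ) : IsFaceSet d t J := by
  have hdeg : (rootPoly t J).natDegree ≤ d := by rw [natDegree_rootPoly]; omega
  set a : ℝ := if ε then s ⟨k, hk⟩ else -s ⟨k, hk⟩ with ha
  refine ⟨Finset.card_pos.1 (by omega), C a * rootPoly t J,
    (natDegree_C_mul_le _ _).trans hdeg, fun i hi => ?_, fun i hi => ?_⟩
  · simp [eval_rootPoly_of_mem hi]
  · have h1 := h.2 i (Finset.mem_univ i) hi
    have h2 := hs.sign_iff hk hJ hi
    rw [eval_mul, eval_C]
    cases ε
    · have := h2.1.2 h1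
      simp only [ha, Bool.false_eq_true, if_false]
      linarith
    · simpa [ha] using h2.2.2 h1

theorem isFaceSet_of_isSection (ht : Function.Injective t)
    (hn : d < n) (hs : SignCompatible t s f q) {F : Set (Fin d → ℝ)}
    (hF : IsFace (cyclicPolytope d t) F) {k : ℕ} (hk : k < dim F) {J : Finset (Fin n)}
    (hJ : J.card = k + 1) {ε : Bool} (h : IsSection f q ε J (vertexSet t F)) : IsFaceSet d t J := by
  obtain ⟨hIf, hFI⟩ := isFaceSet_vertexSet hn hF
  have hd := dim_le F
  rcases hIf.card_le_or_eq_univ ht with hc | hu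
  · exact hIf.subset ht (by omega) h.1 (Finset.card_pos.1 (by omega))
  · exact isFaceSet_of_isSection_univ hs (hk.trans_le hd) hJ (hu ▸ h)

/-! ### The boundary of a face, coefficient by coefficient -/

open scoped Classical in
theorem finsum_single_apply {α : Type*} [Finite α] (p : α → Prop) (b : α) :
    (∑ᶠ (a : α) (_ : p a), Finsupp.single a (1 : ℤ)) b = if p b then 1 else 0 := by
  have := Fintype.ofFinite α
  rw [finsum_eq_sum_of_fintype, Finsupp.finsetSum_apply]
  simp only [finsum_eq_if]
  rw [Finset.sum_eq_single b]
  · split_ifs <;> simp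
  · intro a _ hab
    split_ifs <;> simp [hab]
  · simp

/-- The boundary of a face, as a chain of faces. -/
def faceBoundary (P : Set (Fin d → ℝ)) (β : Set (Fin d → ℝ) → ExteriorAlgebra ℝ (Fin d → ℝ))
    {k : ℕ} (F : {F : Set (Fin d → ℝ) // IsFace P F ∧ dim F = k + 1}) :
    {E : Set (Fin d → ℝ) // IsFace P E ∧ dim E = k} →₀ ℤ :=
  (∑ᶠ (E : {E : Set (Fin d → ℝ) // IsFace P E ∧ dim E = k}) (_ : E.1 ∈ target β F.1),
      Finsupp.single E (1 : ℤ)) -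
    (∑ᶠ (E : {E : Set (Fin d → ℝ) // IsFace P E ∧ dim E = k}) (_ : E.1 ∈ source β F.1),
      Finsupp.single E (1 : ℤ))

open scoped Classical in
theorem faceBoundary_apply (P : Set (Fin d → ℝ))
    (β : Set (Fin d → ℝ) → ExteriorAlgebra ℝ (Fin d → ℝ)) {k : ℕ}
    [Finite {E : Set (Fin d → ℝ) // IsFace P E ∧ dim E = k}]
    (F : {F : Set (Fin d → ℝ) // IsFace P F ∧ dim F = k + 1})
    (E : {E : Set (Fin d → ℝ) // IsFace P E ∧ dim E = k}) :
    faceBoundary P β F E =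
      (if E.1 ∈ target β F.1 then 1 else 0) - if E.1 ∈ source β F.1 then 1 else 0 := by
  rw [faceBoundary, Finsupp.sub_apply, finsum_single_apply, finsum_single_apply]

theorem chains_bd_basisElt (P : Set (Fin d → ℝ))
    (β : Set (Fin d → ℝ) → ExteriorAlgebra ℝ (Fin d → ℝ)) {k : ℕ}
    (F : {F : Set (Fin d → ℝ) // IsFace P F ∧ dim F = k + 1}) :
    (chains P β).bd k ((chains P β).basisElt F) = faceBoundary P β F := by
  change Finsupp.linearCombination ℤ (faceBoundary P β) (Finsupp.single F 1) = faceBoundary P β F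
  rw [Finsupp.linearCombination_single, one_smul]

theorem vertexSet_injOn (hn : d < n) {E F : Set (Fin d → ℝ)} (hE : IsFace (cyclicPolytope d t) E)
    (hF : IsFace (cyclicPolytope d t) F) (h : vertexSet t E = vertexSet t F) : E = F := by
  rw [(isFaceSet_vertexSet hn hE).2, (isFaceSet_vertexSet hn hF).2, h]

/-- The chain complex of a cyclic polytope with a diagonal frame. -/
def cyclicModel (hv : ∀ i, v i = Pi.single i (s i)) (ht : Function.Injective t)
    (hn : d < n) (hs : SignCompatible t s f q) :
    VertexModel (framedChains (cyclicPolytope d t) v) f q where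
  vert k F := vertexSet t F.1
  vert_injective k E F h := Subtype.ext (vertexSet_injOn hn E.2.1 F.2.1 h)
  card_vert {k m} E F hkm := by
    have h1 := dim_le F.1
    rw [F.2.2] at h1
    rw [card_vertexSet ht hn E.2.1 (by rw [E.2.2]; omega), E.2.2]
  lt_card_vert {k} E := by
    obtain ⟨hI, hE⟩ := isFaceSet_vertexSet hn E.2.1
    have h1 := dim_hull_lt_card (d := d) (t := t) hI.1
    have h2 := E.2.2
    have h3 := congrArg dim hE
    exact (h2.symm.trans h3).trans_lt h1
  exists_cell {ε k m} F J hkm hJ h := by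
    have hface := isFaceSet_of_isSection ht hn hs F.2.1 (by rw [F.2.2]; exact hkm) hJ h
    have hm : m ≤ d := by rw [← F.2.2]; exact dim_le _
    exact ⟨⟨momentHull d t J, hface.isFace.1, dim_hull_of_card ht (by omega) hJ⟩, hface.isFace.2⟩
  bd_apply {k} F E := by
    classical
    have hfin : Finite {E : Set (Fin d → ℝ) // IsFace (cyclicPolytope d t) E ∧ dim E = k} :=
      Finite.of_injective (fun E => vertexSet t E.1) fun E F h =>
        Subtype.ext (vertexSet_injOn hn E.2.1 F.2.1 h)
    have h := mem_source_target_iff_isSection hv ht hn hs F.2.1 E.2.1 (by rw [E.2.2, F.2.2])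
    refine (DFunLike.congr_fun (chains_bd_basisElt _ v.orientation F) E).trans
      ((faceBoundary_apply _ _ F E).trans ?_)
    exact congrArg₂ _ (if_congr h.2 rfl rfl) (if_congr h.1 rfl rfl)
  aug_eq := rfl

/-- Vertex sets strictly increase in the Gray order along an inhomogeneous string, so no face
recurs. -/
theorem stronglyLoopFree_cyclicPolytope (hv : ∀ i, v i = Pi.single i (s i))
    (ht : Function.Injective t) (hn : d < n) (hf : Function.Injective f)
    (hs : SignCompatible t s f q) : StronglyLoopFree (cyclicPolytope d t) v := by
  rintro m F ⟨⟨hface, hstep⟩, i, j, hij, heq⟩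
  have step : ∀ i j : Fin m, (j : ℕ) = i + 1 →
      GrayLT f q (vertexSet t (F i)) (vertexSet t (F j)) := by
    intro i j hij
    rcases hstep i j hij with h | h
    · have hdim := h.1.2
      have h1 := (mem_source_target_iff_isSection hv ht hn hs (hface j) (hface i) hdim).1.1 h
      refine (cyclicModel hv ht hn hs).grayLT_source hf (k := dim (F i)) (m := dim (F j))
        ⟨F i, hface i, rfl⟩ ⟨F j, hface j, rfl⟩ (by omega) h1
    · have hdim := h.1.2
      have h1 := (mem_source_target_iff_isSection hv ht hn hs (hface i) (hface j) hdim).2.1 h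
      exact (cyclicModel hv ht hn hs).grayLT_target hf (k := dim (F j)) (m := dim (F i))
        ⟨F j, hface j, rfl⟩ ⟨F i, hface i, rfl⟩ (by omega) h1
  have mono : ∀ (e : ℕ) (i j : Fin m), (j : ℕ) = i + e + 1 →
      GrayLT f q (vertexSet t (F i)) (vertexSet t (F j)) := by
    intro e
    induction e with
    | zero => exact step
    | succ e ih =>
      intro i j hij
      have hlt : (i : ℕ) + e + 1 < m := by omega
      exact (ih i ⟨_, hlt⟩ rfl).trans hf (step ⟨_, hlt⟩ j (by simp; omega))
  rcases lt_or_gt_of_ne hij with h | h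
  · have := mono (j - i - 1) i j (by have : (i : ℕ) < j := h; omega)
    rw [heq] at this
    exact GrayLT.irrefl _ this
  · have := mono (i - j - 1) j i (by have : (j : ℕ) < i := h; omega)
    rw [heq] at this
    exact GrayLT.irrefl _ this

end Cyclic

/-! ### Isomorphisms between complexes with the same vertex sets -/

namespace VertexModel

variable {C D : BasedData} {ι : Type} {f : ι → ℝ} {q : ℕ}

theorem bd_mapDomain (M : VertexModel C f q) (N : VertexModel D f q)
    (e : ∀ k, C.Cell k ≃ D.Cell k) (he : ∀ k E, N.vert k (e k E) = M.vert k E) (k : ℕ)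
    (c : C.Chain (k + 1)) :
    Finsupp.domLCongr (R := ℤ) (M := ℤ) (e k) (C.bd k c) =
      D.bd k (Finsupp.domLCongr (R := ℤ) (M := ℤ) (e (k + 1)) c) := by
  have : (Finsupp.domLCongr (R := ℤ) (M := ℤ) (e k)).toLinearMap.comp (C.bd k) =
      (D.bd k).comp (Finsupp.domLCongr (R := ℤ) (M := ℤ) (e (k + 1))).toLinearMap := by
    refine Finsupp.lhom_ext' fun F => LinearMap.ext_ring (Finsupp.ext fun E => ?_)
    obtain ⟨E, rfl⟩ := (e k).surjective E
    simp only [LinearMap.comp_apply, Finsupp.lsingle_apply, LinearEquiv.coe_coe,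
      Finsupp.domLCongr_apply, Finsupp.domCongr_apply, Finsupp.equivMapDomain_apply,
      Equiv.symm_apply_apply, Finsupp.equivMapDomain_single]
    rw [M.bd_apply, N.bd_apply, he, he]
  exact LinearMap.congr_fun this c

theorem aug_mapDomain (M : VertexModel C f q) (N : VertexModel D f q) (e : C.Cell 0 ≃ D.Cell 0)
    (c : C.Chain 0) : D.aug (Finsupp.domLCongr (R := ℤ) (M := ℤ) e c) = C.aug c := by
  have : D.aug.comp (Finsupp.domLCongr (R := ℤ) (M := ℤ) e).toLinearMap = C.aug := by
    refine Finsupp.lhom_ext' fun F => LinearMap.ext_ring ?_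
    simp [M.aug_eq, N.aug_eq]
  exact LinearMap.congr_fun this c

/-- The chain map induced by a bijection of cells that preserves vertices. -/
def hom (M : VertexModel C f q) (N : VertexModel D f q)
    (e : ∀ k, C.Cell k ≃ D.Cell k) (he : ∀ k E, N.vert k (e k E) = M.vert k E) : C.Hom D where
  map k := (Finsupp.domLCongr (R := ℤ) (M := ℤ) (e k)).toLinearMap
  map_bd := M.bd_mapDomain N e he
  map_aug := M.aug_mapDomain N (e 0)
  map_nonneg k b := by
    simp only [LinearEquiv.coe_coe, Finsupp.domLCongr_single]
    exact Finsupp.single_nonneg.2 zero_le_one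

/-- Complexes whose cells have the same sets of vertices are isomorphic. -/
theorem nonempty_iso (M : VertexModel C f q) (N : VertexModel D f q)
    (h : ∀ k, Set.range (M.vert k) = Set.range (N.vert k)) : Nonempty (C.Iso D) := by
  have hex : ∀ k, ∃ e : C.Cell k ≃ D.Cell k, ∀ E, N.vert k (e E) = M.vert k E := by
    intro k
    refine ⟨((Equiv.ofInjective _ (M.vert_injective k)).trans (Equiv.setCongr (h k))).trans
      (Equiv.ofInjective _ (N.vert_injective k)).symm, fun E => ?_⟩
    exact Equiv.apply_ofInjective_symm (N.vert_injective k) _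
  choose e he using hex
  refine ⟨⟨M.hom N e he, N.hom M (fun k => (e k).symm) fun k E => ?_, fun k c => ?_, fun k c => ?_⟩⟩
  · rw [← he, Equiv.apply_symm_apply]
  · exact (Finsupp.domLCongr (R := ℤ) (M := ℤ) (e k)).symm_apply_apply c
  · exact (Finsupp.domLCongr (R := ℤ) (M := ℤ) (e k)).apply_symm_apply c

end VertexModel

/-! ### The oriental -/

section Oriental

variable {d : ℕ} {t : Fin (d + 1) → ℝ}

theorem card_filter_lt_orderEmbOfFin {α : Type*} [LinearOrder α] {s : Finset α} {k : ℕ}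
    (h : s.card = k) (i : Fin k) : (s.filter (· < s.orderEmbOfFin h i)).card = i := by
  have : s.filter (· < s.orderEmbOfFin h i) =
      (Finset.Iio i).map (s.orderEmbOfFin h).toEmbedding := by
    ext a
    simp only [Finset.mem_filter, Finset.mem_map, Finset.mem_Iio, RelEmbedding.coe_toEmbedding]
    constructor
    · rintro ⟨ha, hlt⟩
      have : a ∈ Set.range (s.orderEmbOfFin h) := by rwa [Finset.range_orderEmbOfFin]
      obtain ⟨j, rfl⟩ := this
      exact ⟨j, (s.orderEmbOfFin h).lt_iff_lt.1 hlt, rfl⟩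
    · rintro ⟨j, hj, rfl⟩
      exact ⟨Finset.orderEmbOfFin_mem _ _ _, (s.orderEmbOfFin h).lt_iff_lt.2 hj⟩
  rw [this, Finset.card_map, Fin.card_Iio]

open scoped Classical in
theorem oriental_boundary_apply (ht : StrictMono t) {k : ℕ}
    (F : {s : Finset (Fin (d + 1)) // s.card = k + 2})
    (E : {s : Finset (Fin (d + 1)) // s.card = k + 1}) :
    (∑ i : Fin (k + 2), Finsupp.single (deleteNth F i) ((-1 : ℤ) ^ (i : ℕ))) E =
      (if IsSection (fun i => -t i) 1 true E.1 F.1 then 1 else 0) -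
        if IsSection (fun i => -t i) 1 false E.1 F.1 then 1 else 0 := by
  rw [Finsupp.finsetSum_apply]
  by_cases hEF : E.1 ⊆ F.1
  swap
  · rw [Finset.sum_eq_zero]
    · simp [IsSection, hEF]
    · intro i _
      rw [Finsupp.single_apply, if_neg]
      rintro rfl
      exact hEF (Finset.erase_subset _ _)
  obtain ⟨r, hr, hrF⟩ : ∃ r, r ∉ E.1 ∧ insert r E.1 = F.1 :=
    Finset.exists_eq_insert_iff.2 ⟨hEF, by rw [E.2, F.2]⟩
  have hrange : r ∈ Set.range (F.1.orderEmbOfFin F.2) := by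
    rw [Finset.range_orderEmbOfFin, ← hrF]
    simp
  obtain ⟨i, hi⟩ := hrange
  have hdel : deleteNth F i = E := by
    refine Subtype.ext ?_
    change F.1.erase (F.1.orderEmbOfFin F.2 i) = E.1
    rw [hi, ← hrF, Finset.erase_insert hr]
  -- For f = -t the elements above `r` are the smaller indices, of which there are `i`. The shift q
  -- = 1 turns -(-1)^(i+1) into the simplicial sign (-1)^i.
  have hlevel : level (fun i => -t i) 1 E.1 r = i + 1 := by
    rw [level]
    congr 1
    rw [← card_filter_lt_orderEmbOfFin F.2 i, hi, ← hrF, Finset.filter_insert,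
      if_neg (lt_irrefl r)]
    simp only [neg_lt_neg_iff, ht.lt_iff_lt]
  conv_rhs => rw [← hrF]
  rw [isSection_insert_sub hr, hlevel, Finset.sum_eq_single i]
  · rw [hdel, Finsupp.single_eq_same]
    ring
  · intro j _ hj
    rw [Finsupp.single_apply, if_neg]
    intro h
    have h1 : F.1.erase (F.1.orderEmbOfFin F.2 j) = F.1.erase (F.1.orderEmbOfFin F.2 i) :=
      congrArg Subtype.val (h.trans hdel.symm)
    have h2 := Finset.erase_injOn F.1 (Finset.orderEmbOfFin_mem _ F.2 j)
      (Finset.orderEmbOfFin_mem _ F.2 i) h1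
    exact hj ((F.1.orderEmbOfFin F.2).injective h2)
  · simp

theorem streetOriental_bd_basisElt {k : ℕ} (F : {s : Finset (Fin (d + 1)) // s.card = k + 2}) :
    (streetOriental d).bd k ((streetOriental d).basisElt (n := k + 1) F) =
      ∑ i : Fin (k + 2), Finsupp.single (deleteNth F i) ((-1 : ℤ) ^ (i : ℕ)) := by
  change Finsupp.linearCombination ℤ (fun F => ∑ i : Fin (k + 2),
    Finsupp.single (deleteNth F i) ((-1 : ℤ) ^ (i : ℕ))) (Finsupp.single F 1) = _
  rw [Finsupp.linearCombination_single, one_smul]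

/-- The vertices of the cells of the oriental. -/
def orientalModel (ht : StrictMono t) :
    VertexModel (streetOriental d) (fun i => -t i) 1 where
  vert _ E := E.1
  vert_injective _ := Subtype.val_injective
  card_vert E _ _ := E.2
  lt_card_vert {k} E := by
    have h : E.1.card = k + 1 := E.2
    omega
  exists_cell _ J _ hJ _ := ⟨⟨J, hJ⟩, rfl⟩
  bd_apply F E := (DFunLike.congr_fun (streetOriental_bd_basisElt F) E).trans
    (oriental_boundary_apply ht F E)
  aug_eq := rfl

/-- Every non-empty set of vertices of the cyclic simplex spans a face. -/
theorem isFaceSet_simplex (ht : Function.Injective t) {I : Finset (Fin (d + 1))}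
    (hI : I.Nonempty) : IsFaceSet d t I := by
  -- The zero polynomial exposes the whole simplex, and its d + 1 vertices are few enough for
  -- passing to subsets.
  have huniv : IsFaceSet d t Finset.univ :=
    ⟨Finset.univ_nonempty, 0, by simp, by simp, fun i hi => absurd (Finset.mem_univ i) hi⟩
  exact huniv.subset ht (by simp) (Finset.subset_univ I) hI

/-- For n = d + 1 the top cell also has one more vertex than its dimension, so degree and
cardinality correspond in all degrees. -/
theorem range_vert_simplex (ht : StrictMono t) {v : Frame d} {s : Fin d → ℝ}
    (hv : ∀ i, v i = Pi.single i (s i)) (hs : SignCompatible t s (fun i => -t i) 1) (k : ℕ) :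
    Set.range ((cyclicModel hv ht.injective d.lt_succ_self hs).vert k) =
      Set.range ((orientalModel ht).vert k) := by
  ext J
  constructor
  · rintro ⟨E, rfl⟩
    refine ⟨⟨vertexSet t E.1, ?_⟩, rfl⟩
    obtain ⟨hI, hE⟩ := isFaceSet_vertexSet d.lt_succ_self E.2.1
    have h1 := hI.dim_cases ht.injective d.lt_succ_self
    have h2 := (congrArg dim hE).symm.trans E.2.2
    rcases h1 with h | ⟨h3, h4⟩
    · omega
    · rw [h4, Finset.card_univ, Fintype.card_fin]
      omega
  · rintro ⟨⟨J, hJ⟩, rfl⟩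
    have hface := isFaceSet_simplex (d := d) ht.injective (I := J) (Finset.card_pos.1 (by omega))
    have hk : J.card ≤ d + 1 := by simpa using Finset.card_le_univ J
    exact ⟨⟨momentHull d t J, hface.isFace.1, dim_hull_of_card ht.injective (by omega) hJ⟩,
      hface.isFace.2⟩

end Oriental

/-! ### The two frames are diagonal -/

theorem canonicalFrame_apply {d : ℕ} (i : Fin d) : canonicalFrame d i = Pi.single i 1 := by
  simp [canonicalFrame]

theorem alternatingFrame_apply {d : ℕ} (i : Fin d) :
    alternatingFrame d i = Pi.single i ((-1) ^ (i : ℕ)) := by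
  rw [alternatingFrame, Module.Basis.unitsSMul_apply, canonicalFrame_apply, Units.smul_def,
    ← Pi.single_smul]
  simp

end FramedPolytope

end

theorem mainTheorem5 :
    (∀ (d : ℕ) (t : Fin (d + 1) → ℝ), StrictMono t →
      (FramedPolytope.alternatingFrame d).Admissible (FramedPolytope.cyclicPolytope d t) ∧
      FramedPolytope.StronglyLoopFree (FramedPolytope.cyclicPolytope d t)
        (FramedPolytope.alternatingFrame d) ∧
      (FramedPolytope.framedChains (FramedPolytope.cyclicPolytope d t)
        (FramedPolytope.alternatingFrame d)).IsStrongSteinerDiagram ∧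
      Nonempty ((FramedPolytope.framedChains (FramedPolytope.cyclicPolytope d t)
        (FramedPolytope.alternatingFrame d)).Iso (FramedPolytope.streetOriental d))) ∧
    (∀ (n d : ℕ) (t : Fin n → ℝ), d < n → StrictMono t →
      (FramedPolytope.canonicalFrame d).Admissible (FramedPolytope.cyclicPolytope d t) ∧
      FramedPolytope.StronglyLoopFree (FramedPolytope.cyclicPolytope d t)
        (FramedPolytope.canonicalFrame d) ∧
      (FramedPolytope.framedChains (FramedPolytope.cyclicPolytope d t)
        (FramedPolytope.canonicalFrame d)).IsStrongSteinerDiagram) := by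
  open FramedPolytope in
  refine ⟨fun d t ht => ?_, fun n d t hn ht => ?_⟩
  · have hv := alternatingFrame_apply (d := d)
    have hs := signCompatible_alternating (d := d) ht.injective
    have hf : Function.Injective fun i => -t i := neg_injective.comp ht.injective
    have hn := d.lt_succ_self
    exact ⟨admissible_cyclicPolytope hv ht.injective hn,
      stronglyLoopFree_cyclicPolytope hv ht.injective hn hf hs,
      (cyclicModel hv ht.injective hn hs).isStrongSteinerDiagram hf,
      (cyclicModel hv ht.injective hn hs).nonempty_iso (orientalModel ht)
        (range_vert_simplex ht hv hs)⟩
  · have hv := canonicalFrame_apply (d := d)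
    have hs := signCompatible_canonical (d := d) ht.injective
    exact ⟨admissible_cyclicPolytope hv ht.injective hn,
      stronglyLoopFree_cyclicPolytope hv ht.injective hn ht.injective hs,
      (cyclicModel hv ht.injective hn hs).isStrongSteinerDiagram ht.injective⟩
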